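/- Let the infinite tadpole graph consist of a head $[0,1]$, both of whose ends are the vertex $v$, and a tail $[0,\infty)$ starting at $v$. Let $L^2_p$ be the Hilbert space of pairs $\psi=(\psi^1,\psi^2)$ with $\psi^1\in L^2(0,1)$ and $\psi^2\in L^2_{loc}([0,\infty))$ of period $1$ (complex-valued), with $$\langle\psi,\chi\rangle=\int_0^1\overline{\psi^1}\chi^1\,dx+\int_0^1\overline{\psi^2}\chi^2\,dx .$$ Let $A=-\Delta$ act on those $\psi\in L^2_p$ that are in $H^2(0,1)\times H^2_{loc}([0,\infty))$ and satisfy $\psi^1(0)=\psi^1(1)=\psi^2(0)$ and $\partial_x\psi^1(0)-\partial_x\psi^1(1)+\partial_x\psi^2(0)=0$. Let $B(\psi^1,\psi^2)=(V^1\psi^1,V^2\psi^2)$ with $$V^1(x)=x^2(x-1)^2,\qquad V^2(x)=\sum_{n\ge 0}(x-n)^2(x-n-1)^2\chi_{[n,n+1]}(x).$$ Put $\varphi_1=(\tfrac{\sqrt2}{2},\tfrac{\sqrt2}{2})$, $\varphi_k=(\cos(2(k-1)\pi x),\cos(2(k-1)\pi x))$ for $k\ge2$, and $\mu_k=4(k-1)^2\pi^2$.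 Let $\mathcal H(\varphi)$ be the closed linear span of the $\varphi_k$ in $L^2_p$, and let $H^4_{\mathcal T}(\varphi)$ be the space of all $\psi\in\mathcal H(\varphi)$ with $\|\psi\|_{(4)}^2:=\sum_{k\ge1}|k^4\langle\varphi_k,\psi\rangle|^2<\infty$, with the norm $\|\cdot\|_{(4)}$. **Proposition 3.3.** The $\varphi_k$ form an orthonormal system of eigenfunctions of $A$, with $A\varphi_k=\mu_k\varphi_k$, and $B$ maps $\mathcal H(\varphi)$ into itself. On $\mathcal H(\varphi)$ let $e^{i\Delta t}f=\sum_{k\ge1}e^{-i\mu_kt}\langle\varphi_k,f\rangle\varphi_k$. For $0\le t_0\le T$, call $\psi:[t_0,T]\to\mathcal H(\varphi)$ a mild solution of $i\partial_t\psi=-\Delta\psi+u(t)B\psi$ on $[t_0,T]$ with datum $\psi_0$ at time $t_0$ if for all $t\in[t_0,T]$ $$\psi(t)=e^{i\Delta (t-t_0)}\psi_0-i\int_{t_0}^te^{i\Delta(t-s)}u(s)B\psi(s)\,ds ,$$ where the integral is a (convergent) Bochner integral in $L^2_p$. Let $T>0$ and $u\in L^2((0,T),\mathbb R)$. 1. For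 every $\psi_0\in H^4_{\mathcal T}(\varphi)$ there is a unique mild solution $\psi\in C^0([0,T],H^4_{\mathcal T}(\varphi))$ on $[0,T]$ with datum $\psi_0$ at time $0$. 2. There is a unitary propagator $(\Gamma(t,s))_{s,t\in[0,T]}$ on $\mathcal H(\varphi)$ for the $L^2_p$-norm (each $\Gamma(t,s)$ is a unitary operator on $\mathcal H(\varphi)$, $\Gamma(t,t)=I$, $\Gamma(t,r)\Gamma(r,s)=\Gamma(t,s)$, and $(t,s)\mapsto\Gamma(t,s)f$ is continuous on $[0,T]^2$ for every $f$) such that for every $s\in[0,T]$ and $f\in\mathcal H(\varphi)$ the function $t\mapsto\Gamma(t,s)f$ is a mild solution on $[s,T]$ with datum $f$ at time $s$, and every mild solution $\psi\in C^0([s,T],\mathcal H(\varphi))$ with datum $f$ at time $s$ satisfies $\psi(t)=\Gamma(t,s)f$ for all $t\in[s,T]$. In particular $\Gamma^u_t:=\Gamma(t,0)$ satisfies $\Gamma^u_t\psi_0=\psi(t)$ for every solution $\psi$ with initial datum $\psi_0\in\mathcal H(\varphi)$. -/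

import Mathlib

open MeasureTheory Set Filter Topology

noncomputable section

namespace Tadpole

/-! The infinite tadpole graph: a head of length `1`, with coordinate in `[0, 1]`, and a tail
`[0, ∞)` attached to it at the vertex `v` (coordinates `0` and `1` on the head, `0` on the tail).

A `1`-periodic function on the tail `[0, ∞)` is the same thing as a function on the circle `ℝ / ℤ`:
its value at `x ≥ 0` is the value of the latter at the class `(x : UnitAddCircle)` of `x`. -/

/-- `L²` of the head `[0, 1]`. -/
abbrev Head : Type := Lp ℂ 2 (volume.restrict (Icc (0 : ℝ) 1))

/-- The `1`-periodic locally square integrable functions on the tail, with the inner product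
`∫₀¹ conj f * g`. -/
abbrev Tail : Type := Lp ℂ 2 (volume : Measure UnitAddCircle)

/-- The Hilbert space `L²_p`, with inner product
`⟪ψ, χ⟫ = ∫₀¹ conj ψ¹ * χ¹ + ∫₀¹ conj ψ² * χ²`. -/
abbrev L2p : Type := WithLp 2 (Head × Tail)

/-- The number in `[0, 1)` that represents a point of `ℝ / ℤ`. -/
def rep (y : UnitAddCircle) : ℝ := (AddCircle.measurableEquivIco (1 : ℝ) 0 y : ℝ)

theorem measurable_rep : Measurable rep :=
  measurable_subtype_coe.comp (AddCircle.measurableEquivIco (1 : ℝ) 0).measurable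

theorem rep_mem (y : UnitAddCircle) : 0 ≤ rep y ∧ rep y < 1 := by
  have h := (AddCircle.measurableEquivIco (1 : ℝ) 0 y).2
  simpa [rep] using h

theorem rep_coe (x : ℝ) : rep (x : UnitAddCircle) = Int.fract x := by
  have h := AddCircle.coe_equivIco_mk_apply (1 : ℝ) x
  simp only [div_one, mul_one] at h
  exact h

/-! ### The Laplacian with Neumann-Kirchhoff conditions -/

/-- `ψ ∈ D(A)` and `A ψ = χ`, where `A = -Δ` with Neumann-Kirchhoff conditions at `v`: on each of
the two edges `ψ` has a representative `f` that is differentiable up to the boundary, with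
derivative `d` that is an indefinite integral of `-χ` (this is `ψ ∈ H²_p` and `-ψ'' = χ ∈ L²_p`);
these representatives are continuous at `v` and satisfy the Kirchhoff condition there. -/
def IsLaplacian (ψ χ : L2p) : Prop :=
  ∃ f₁ d₁ f₂ d₂ : ℝ → ℂ,
    (∀ᵐ x : ℝ ∂(volume.restrict (Icc (0 : ℝ) 1)), ψ.fst x = f₁ x) ∧
    (∀ x ∈ Icc (0 : ℝ) 1, HasDerivWithinAt f₁ (d₁ x) (Icc 0 1) x) ∧
    (∀ x ∈ Icc (0 : ℝ) 1, d₁ x = d₁ 0 - ∫ y in (0 : ℝ)..x, χ.fst y) ∧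
    (∀ᵐ x : ℝ ∂(volume.restrict (Ici (0 : ℝ))), ψ.snd (x : UnitAddCircle) = f₂ x) ∧
    (∀ x ∈ Ici (0 : ℝ), HasDerivWithinAt f₂ (d₂ x) (Ici 0) x) ∧
    (∀ x ∈ Ici (0 : ℝ), d₂ x = d₂ 0 - ∫ y in (0 : ℝ)..x, χ.snd (y : UnitAddCircle)) ∧
    f₁ 0 = f₁ 1 ∧ f₁ 0 = f₂ 0 ∧ d₁ 0 - d₁ 1 + d₂ 0 = 0

/-! ### The eigenfunctions -/

/-- The common profile on `[0, 1]` and on the tail of the two components of the `k`-th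
eigenfunction. -/
def profile (k : ℕ+) (x : ℝ) : ℂ :=
  if k = 1 then ((Real.sqrt 2 / 2 : ℝ) : ℂ)
  else ((Real.cos (2 * ((k : ℝ) - 1) * Real.pi * x) : ℝ) : ℂ)

theorem continuous_profile (k : ℕ+) : Continuous (profile k) := by
  unfold profile
  split_ifs <;> fun_prop

theorem norm_profile_le (k : ℕ+) (x : ℝ) : ‖profile k x‖ ≤ 1 := by
  unfold profile
  split_ifs
  · rw [Complex.norm_real, Real.norm_of_nonneg (by positivity)]
    have : Real.sqrt 2 ≤ 2 := Real.sqrt_le_iff.2 ⟨by norm_num, by norm_num⟩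
    linarith
  · rw [Complex.norm_real]
    exact Real.abs_cos_le_one _

theorem profile_add_one (k : ℕ+) (x : ℝ) : profile k (x + 1) = profile k x := by
  unfold profile
  split_ifs
  · rfl
  · have h : 2 * ((k : ℝ) - 1) * Real.pi * (x + 1)
        = 2 * ((k : ℝ) - 1) * Real.pi * x + (((k : ℤ) - 1 : ℤ) : ℝ) * (2 * Real.pi) := by
      push_cast; ring
    rw [h, Real.cos_add_int_mul_two_pi]

theorem profile_rep_coe (k : ℕ+) (x : ℝ) : profile k (rep (x : UnitAddCircle)) = profile k x := by
  have hp : Function.Periodic (profile k) 1 := profile_add_one k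
  rw [rep_coe, Int.fract, ← mul_one ((⌊x⌋ : ℤ) : ℝ)]
  exact hp.sub_int_mul_eq ⌊x⌋

theorem memLp_profile_head (k : ℕ+) :
    MemLp (profile k) 2 (volume.restrict (Icc (0 : ℝ) 1)) :=
  MemLp.of_bound (continuous_profile k).aestronglyMeasurable 1
    (Eventually.of_forall (norm_profile_le k))

theorem memLp_profile_tail (k : ℕ+) :
    MemLp (fun y : UnitAddCircle => profile k (rep y)) 2 volume :=
  MemLp.of_bound
    ((continuous_profile k).measurable.comp measurable_rep).aestronglyMeasurable 1
    (Eventually.of_forall fun _ => norm_profile_le k _)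

/-- `φ₁ = (√2/2, √2/2)` and `φ_k = (cos (2(k-1)πx), cos (2(k-1)πx))` for `k ≥ 2`. -/
def φ (k : ℕ+) : L2p :=
  WithLp.toLp 2 ((memLp_profile_head k).toLp _, (memLp_profile_tail k).toLp _)

/-- The eigenvalues `μ_k = 4(k-1)²π²`. -/
def μ (k : ℕ+) : ℝ := 4 * ((k : ℝ) - 1) ^ 2 * Real.pi ^ 2

/-! ### The spaces `ℋ(φ)` and `H^s(φ)` -/

/-- `ℋ(φ)`: the closed linear span of the `φ_k` in `L²_p`. -/
def Hφ : Submodule ℂ L2p := (Submodule.span ℂ (range φ)).topologicalClosure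

/-- `H^s(φ) = {ψ ∈ ℋ(φ) : ∑ₖ |k^s ⟪φ_k, ψ⟫|² < ∞}`. -/
def Hs (s : ℝ) : Set L2p :=
  {ψ | ψ ∈ Hφ ∧ Summable fun k : ℕ+ => ((k : ℝ) ^ s * ‖inner ℂ (φ k) ψ‖) ^ 2}

/-- The norm `‖ψ‖_(s) = (∑ₖ |k^s ⟪φ_k, ψ⟫|²)^(1/2)`, meaningful for `ψ ∈ H^s(φ)`. -/
def normHs (s : ℝ) (ψ : L2p) : ℝ :=
  Real.sqrt (∑' k : ℕ+, ((k : ℝ) ^ s * ‖inner ℂ (φ k) ψ‖) ^ 2)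

/-- `ψ ∈ C⁰(J, H^s(φ))`, for the norm `‖·‖_(s)`. -/
def ContinuousInHs (s : ℝ) (J : Set ℝ) (ψ : ℝ → L2p) : Prop :=
  (∀ t ∈ J, ψ t ∈ Hs s) ∧
    ∀ t₀ ∈ J, Tendsto (fun t => normHs s (ψ t - ψ t₀)) (𝓝[J] t₀) (𝓝 0)

/-- `ψ ∈ C⁰(J, ℋ(φ))`, for the norm of `L²_p`. -/
def ContinuousInHφ (J : Set ℝ) (ψ : ℝ → L2p) : Prop :=
  (∀ t ∈ J, ψ t ∈ Hφ) ∧ ContinuousOn ψ J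

/-- `e^{iΔt}` on `ℋ(φ)`, the unitary group of the operator with `-Δ φ_k = μ_k φ_k`:
`e^{iΔt} f = ∑ₖ e^{-iμ_k t} ⟪φ_k, f⟫ φ_k`. It is used for `f ∈ ℋ(φ)` only. -/
def freeFlow (t : ℝ) (f : L2p) : L2p :=
  ∑' k : ℕ+, (Complex.exp (-Complex.I * (μ k : ℂ) * (t : ℂ)) * inner ℂ (φ k) f) • φ k

/-! ### The control operator -/

/-- The potential on the head. -/
def V₁ (x : ℝ) : ℝ := x ^ 2 * (x - 1) ^ 2

/-- The potential on the tail, as a function of `x ∈ [0, ∞)`. -/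
def V₂ (x : ℝ) : ℝ :=
  ∑' n : ℕ, (Icc (n : ℝ) (n + 1)).indicator (fun x => (x - n) ^ 2 * (x - n - 1) ^ 2) x

theorem V₂_eq {x : ℝ} (hx : 0 ≤ x) : V₂ x = V₁ (Int.fract x) := by
  have hfl : ((⌊x⌋₊ : ℕ) : ℝ) = (⌊x⌋ : ℝ) := by
    exact natCast_floor_eq_intCast_floor hx
  unfold V₂
  rw [tsum_eq_single ⌊x⌋₊]
  · have hm : x ∈ Icc ((⌊x⌋₊ : ℕ) : ℝ) ((⌊x⌋₊ : ℕ) + 1) :=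
      ⟨Nat.floor_le hx, (Nat.lt_floor_add_one x).le⟩
    rw [indicator_of_mem hm, V₁, Int.fract, hfl]
  · intro n hn
    by_cases h : x ∈ Icc (n : ℝ) (n + 1)
    · rw [indicator_of_mem h]
      have h1 : x = n + 1 := by
        by_contra hne
        exact hn (((Nat.floor_eq_iff hx).2 ⟨h.1, lt_of_le_of_ne h.2 hne⟩).symm)
      rw [h1]; ring
    · exact indicator_of_notMem h _

/-- The potential on the tail is `1`-periodic: it is seen as a function on `ℝ / ℤ`. -/
def V₂circle (y : UnitAddCircle) : ℝ := V₂ (rep y)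

theorem V₂circle_eq (y : UnitAddCircle) : V₂circle y = V₁ (rep y) := by
  have h := rep_mem y
  rw [V₂circle, V₂_eq h.1, Int.fract_eq_self.2 h]

theorem V₂circle_coe {x : ℝ} (hx : 0 ≤ x) : V₂circle (x : UnitAddCircle) = V₂ x := by
  rw [V₂circle_eq, rep_coe, V₂_eq hx]

theorem abs_V₁_le {x : ℝ} (h0 : 0 ≤ x) (h1 : x ≤ 1) : |V₁ x| ≤ 1 := by
  unfold V₁
  rw [← mul_pow, abs_of_nonneg (sq_nonneg _), sq_le_one_iff_abs_le_one, abs_le]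
  constructor <;> nlinarith

theorem continuous_V₁ : Continuous V₁ := by
  unfold V₁; fun_prop

theorem memLp_head_mul (f : Head) :
    MemLp (fun x => (V₁ x : ℂ) * f x) 2 (volume.restrict (Icc (0 : ℝ) 1)) := by
  refine (Lp.memLp f).of_le ?_ ?_
  · exact (Complex.continuous_ofReal.comp continuous_V₁).aestronglyMeasurable.mul
      (Lp.aestronglyMeasurable f)
  · filter_upwards [ae_restrict_mem measurableSet_Icc] with x hx
    rw [norm_mul, Complex.norm_real, Real.norm_eq_abs]
    exact mul_le_of_le_one_left (norm_nonneg _) (abs_V₁_le hx.1 hx.2)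

theorem memLp_tail_mul (f : Tail) :
    MemLp (fun y => (V₂circle y : ℂ) * f y) 2 (volume : Measure UnitAddCircle) := by
  refine (Lp.memLp f).of_le ?_ (Eventually.of_forall fun y => ?_)
  · have h : Measurable V₂circle := by
      rw [show V₂circle = fun y => V₁ (rep y) from funext V₂circle_eq]
      exact continuous_V₁.measurable.comp measurable_rep
    exact (Complex.measurable_ofReal.comp h).aestronglyMeasurable.mul (Lp.aestronglyMeasurable f)
  · rw [norm_mul, Complex.norm_real, Real.norm_eq_abs, V₂circle_eq]
    exact mul_le_of_le_one_left (norm_nonneg _) (abs_V₁_le (rep_mem y).1 (rep_mem y).2.le)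

/-- The control operator `B (ψ¹, ψ²) = (V¹ψ¹, V²ψ²)`. -/
def B (ψ : L2p) : L2p :=
  WithLp.toLp 2 ((memLp_head_mul ψ.fst).toLp _, (memLp_tail_mul ψ.snd).toLp _)

/-! ### Mild solutions and propagators -/

/-- `ψ` satisfies on `[t₀, T]` the mild form, with datum `ψ₀` at time `t₀`, of
`i ∂ₜψ = -Δψ + u(t) Bψ`, that is
`ψ(t) = e^{iΔ(t-t₀)} ψ₀ - i ∫_{t₀}^t e^{iΔ(t-s)} u(s) B ψ(s) ds`;
the integral is a Bochner integral in `L²_p` and is required to converge. -/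
def IsMild (u : ℝ → ℝ) (t₀ T : ℝ) (ψ₀ : L2p) (ψ : ℝ → L2p) : Prop :=
  ∀ t ∈ Icc t₀ T,
    IntervalIntegrable (fun s => (u s : ℂ) • freeFlow (t - s) (B (ψ s))) volume t₀ t ∧
    ψ t = freeFlow (t - t₀) ψ₀
      - Complex.I • ∫ s in t₀..t, (u s : ℂ) • freeFlow (t - s) (B (ψ s))

/-- A unitary propagator on `ℋ(φ)` over the time interval `[0, T]`: `Γ t s` is a surjective linear
isometry of `ℋ(φ)` for the norm of `L²_p`, which transports states from time `s` to time `t`. -/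
structure IsUnitaryPropagator (T : ℝ) (Γ : ℝ → ℝ → (Hφ ≃ₗᵢ[ℂ] Hφ)) : Prop where
  refl : ∀ t ∈ Icc 0 T, ∀ f : Hφ, Γ t t f = f
  comp : ∀ t ∈ Icc 0 T, ∀ r ∈ Icc 0 T, ∀ s ∈ Icc 0 T, ∀ f : Hφ, Γ t r (Γ r s f) = Γ t s f
  cont : ∀ f : Hφ, ContinuousOn (fun p : ℝ × ℝ => Γ p.1 p.2 f) (Icc 0 T ×ˢ Icc 0 T)

end Tadpole

end

/-!
Everything is computed in the basis `φ_k`. On `ℋ(φ)`, whose elements have equal components on the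
two edges, `B` is the multiplication by the `1`-periodic extension of `V(x) = x²(x-1)²`, which is
`B₄(x) + 1/30` for the fourth Bernoulli polynomial `B₄`. So the Fourier coefficients of `V` are
`-3 / (2π⁴n⁴)` for `n ≠ 0` (`hasSum_Vhat`), and `B` acts on Fourier coefficients as the convolution
with an even summable sequence; in particular it preserves `ℋ(φ)` (`B_mem_Hφ`).

*The propagator.* In the interaction picture `y(t) = e^{itA} ψ(t)` a mild solution becomes a
solution of `y(t) = y(s) + ∫_s^t M(r) y(r) dr` with bounded skew-adjoint `M(r)`, of norm at most
`‖B‖ |u(r)|` (`isMild_iff_isSol`). Since `u ∈ L¹`, an exponential weight makes the Volterra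
operator on the right a contraction (`existsUnique_volterra`), whence existence and uniqueness,
forward and backward in time. The squared norm of a solution is absolutely continuous with derivative `2 Re ⟪y, M y⟫ = 0`,
so that the solution operators are unitary (`exists_unitary_propagator`).

*Solutions in `H⁴(φ)`.* Here `B` is not bounded: the periodic potential is `C²`, but its third
derivative jumps at the vertex. Comparing `n⁻⁴` with `k⁻⁴` in the convolution shows that, for
`ψ ∈ H⁴(φ)`, the sequence `k⁴ ⟪φ_k, B ψ⟫` is a bounded operator applied to `ψ`, with values in `ℓ²`,
plus `c_k ψ(v)` with a bounded sequence `c` that is not in `ℓ²` (`exists_regularPart`). The integral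
in time repairs this singular part of rank one. The `μ_k` are distinct integer multiples of one
frequency, so that Bessel's inequality bounds the `ℓ²` norm of `k ↦ ∫₀ᵗ e^{iμ_k s} h(s) ds` by the
`L²(0, t)` norm of `h` (`exists_bessel`), and `h = u ψ(v)` is square integrable. This gives a
continuous integrated equation in the weighted `ℓ²` space, of Volterra type for the squared norm
with the integrable kernel `|u|²`; its fixed point solves the mild equation, as is checked on
coordinates (`exists_isMild_Hs`). Uniqueness holds already in `L²`.
-/

open scoped lp

noncomputable section

namespace Tadpole

/-! ### Volterra equations with an integrable kernel -/

/-- Absolute continuity passes to a function whose increments are dominated by those of an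
absolutely continuous function. -/
theorem absolutelyContinuousOnInterval_of_dist_le {X Y : Type*} [PseudoMetricSpace X]
    [PseudoMetricSpace Y] {U : ℝ → X} {f : ℝ → Y} {a b C : ℝ} (hC : 0 ≤ C)
    (hU : AbsolutelyContinuousOnInterval U a b)
    (h : ∀ x ∈ uIcc a b, ∀ y ∈ uIcc a b, dist (f x) (f y) ≤ C * dist (U x) (U y)) :
    AbsolutelyContinuousOnInterval f a b := by
  rw [absolutelyContinuousOnInterval_iff] at hU ⊢
  intro ε hε
  obtain ⟨δ, hδ, H⟩ := hU (ε / (C + 1)) (by positivity)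
  refine ⟨δ, hδ, fun E hE hlt => ?_⟩
  have h1 := H E hE hlt
  calc ∑ i ∈ Finset.range E.1, dist (f (E.2 i).1) (f (E.2 i).2)
      ≤ ∑ i ∈ Finset.range E.1, C * dist (U (E.2 i).1) (U (E.2 i).2) :=
        Finset.sum_le_sum fun i hi => h _ (hE.1 i hi).1 _ (hE.1 i hi).2
    _ = C * ∑ i ∈ Finset.range E.1, dist (U (E.2 i).1) (U (E.2 i).2) := by rw [Finset.mul_sum]
    _ ≤ C * (ε / (C + 1)) := by gcongr
    _ < ε := by
        rw [mul_div_assoc', div_lt_iff₀ (by positivity)]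
        nlinarith

/-- The integral of the derivative of `exp (c ∫ g)`, which is only absolutely continuous. -/
theorem integral_mul_exp_integral {g : ℝ → ℝ} (hg : Integrable g) (c t₀ t : ℝ) :
    ∫ r in t₀..t, g r * (c * Real.exp (c * ∫ v in t₀..r, g v))
      = Real.exp (c * ∫ v in t₀..t, g v) - 1 := by
  set U : ℝ → ℝ := fun r => ∫ v in t₀..r, g v with hU
  have hUac : AbsolutelyContinuousOnInterval U t₀ t :=
    hg.intervalIntegrable.absolutelyContinuousOnInterval_intervalIntegral left_mem_uIcc
  obtain ⟨R, hR⟩ :=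
    (isCompact_uIcc.image_of_continuousOn hUac.continuousOn).isBounded.subset_closedBall 0
  have hsm : ContDiff ℝ 1 (fun v : ℝ => Real.exp (c * v)) := by fun_prop
  obtain ⟨K, hK⟩ := hsm.contDiffOn.exists_lipschitzOnWith (s := Metric.closedBall (0 : ℝ) R)
    (by decide) (convex_closedBall _ _) (isCompact_closedBall _ _)
  have hFac : AbsolutelyContinuousOnInterval (fun r => Real.exp (c * U r)) t₀ t :=
    absolutelyContinuousOnInterval_of_dist_le K.2 hUac fun x hx y hy =>
      hK.dist_le_mul _ (hR (mem_image_of_mem _ hx)) _ (hR (mem_image_of_mem _ hy))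
  have h1 := hFac.integral_deriv_eq_sub
  have h0 : U t₀ = 0 := by simp [hU]
  rw [h0, mul_zero, Real.exp_zero] at h1
  rw [← h1]
  refine intervalIntegral.integral_congr_ae ?_
  filter_upwards [hg.intervalIntegrable (a := t₀) (b := t) |>.ae_hasDerivAt_integral] with r hr hmem
  have h2 := (((hr (uIoc_subset_uIcc hmem) t₀ left_mem_uIcc).const_mul c).exp).deriv
  rw [h2]
  ring

/-- The exponential weight that absorbs the kernel `g`: it makes the Volterra operator with
kernel `g` a contraction of ratio `1/2`. -/
def volterraWeight (g : ℝ → ℝ) (t₀ t : ℝ) : ℝ := Real.exp (2 * |∫ v in t₀..t, g v|)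

theorem one_le_volterraWeight (g : ℝ → ℝ) (t₀ t : ℝ) : 1 ≤ volterraWeight g t₀ t :=
  Real.one_le_exp (by positivity)

theorem continuous_volterraWeight {g : ℝ → ℝ} (hg : Integrable g) (t₀ : ℝ) :
    Continuous (volterraWeight g t₀) := by
  have : Continuous fun t => ∫ v in t₀..t, g v :=
    intervalIntegral.continuous_primitive (fun _ _ => hg.intervalIntegrable) t₀
  unfold volterraWeight
  fun_prop

theorem abs_integral_mul_volterraWeight_le {g : ℝ → ℝ} (hg : Integrable g) (hg0 : ∀ t, 0 ≤ g t)
    (t₀ t : ℝ) :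
    |∫ r in t₀..t, g r * volterraWeight g t₀ r| ≤ volterraWeight g t₀ t / 2 := by
  rcases le_total t₀ t with h | h
  · have key := integral_mul_exp_integral hg 2 t₀ t
    have e : ∫ r in t₀..t, g r * (2 * Real.exp (2 * ∫ v in t₀..r, g v))
        = 2 * ∫ r in t₀..t, g r * volterraWeight g t₀ r := by
      rw [← intervalIntegral.integral_const_mul]
      refine intervalIntegral.integral_congr fun r hr => ?_
      rw [uIcc_of_le h] at hr
      simp only [volterraWeight]
      rw [abs_of_nonneg (intervalIntegral.integral_nonneg hr.1 fun x _ => hg0 x)]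
      ring
    rw [e] at key
    have hw : volterraWeight g t₀ t = Real.exp (2 * ∫ v in t₀..t, g v) := by
      rw [volterraWeight, abs_of_nonneg (intervalIntegral.integral_nonneg h fun x _ => hg0 x)]
    have h1 := one_le_volterraWeight g t₀ t
    rw [abs_le]
    constructor <;> linarith
  · have key := integral_mul_exp_integral hg (-2) t₀ t
    have hneg : ∀ r ≤ t₀, |∫ v in t₀..r, g v| = -∫ v in t₀..r, g v := fun r hr => by
      rw [intervalIntegral.integral_symm, abs_neg, neg_neg,
        abs_of_nonneg (intervalIntegral.integral_nonneg hr fun x _ => hg0 x)]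
    have e : ∫ r in t₀..t, g r * (-2 * Real.exp (-2 * ∫ v in t₀..r, g v))
        = -2 * ∫ r in t₀..t, g r * volterraWeight g t₀ r := by
      rw [← intervalIntegral.integral_const_mul]
      refine intervalIntegral.integral_congr fun r hr => ?_
      rw [uIcc_of_ge h] at hr
      simp only [volterraWeight]
      rw [hneg r hr.2]
      ring_nf
    rw [e] at key
    have hw : volterraWeight g t₀ t = Real.exp (-2 * ∫ v in t₀..t, g v) := by
      rw [volterraWeight, hneg t h]; ring_nf
    have h1 := one_le_volterraWeight g t₀ t
    rw [abs_le]
    constructor <;> linarith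

/-- A map of Volterra type on `C([a, b], X)` has exactly one fixed point: its iterates are
eventually contracting, because the exponential weight is eventually beaten by `2⁻ⁿ`. -/
theorem existsUnique_volterra {X : Type*} [NormedAddCommGroup X] [CompleteSpace X] {a b t₀ : ℝ}
    (hab : a ≤ b) (ht₀ : t₀ ∈ Icc a b) {g : ℝ → ℝ} (hg : Integrable g) (hg0 : ∀ t, 0 ≤ g t)
    {p : ℕ} (hp : p ≠ 0) (K : C(Icc a b, X) → C(Icc a b, X))
    (hK : ∀ x y : C(Icc a b, X), ∀ t : Icc a b, ‖K x t - K y t‖ ^ p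
      ≤ |∫ s in t₀..t, g s * ‖x (projIcc a b hab s) - y (projIcc a b hab s)‖ ^ p|) :
    ∃! x, K x = x := by
  have main : ∀ (n : ℕ) (x y : C(Icc a b, X)) (t : Icc a b),
      ‖(K^[n]) x t - (K^[n]) y t‖ ^ p ≤ (1 / 2) ^ n * dist x y ^ p * volterraWeight g t₀ t := by
    intro n
    induction n with
    | zero =>
      intro x y t
      have h1 : ‖x t - y t‖ ≤ dist x y := by
        rw [← dist_eq_norm]; exact ContinuousMap.dist_apply_le_dist t
      have h2 : ‖x t - y t‖ ^ p ≤ dist x y ^ p := by gcongr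
      have h3 := one_le_volterraWeight g t₀ t
      have h4 : 0 ≤ dist x y ^ p := by positivity
      simp only [Function.iterate_zero, id_eq, pow_zero, one_mul]
      nlinarith
    | succ n ih =>
      intro x y t
      rw [Function.iterate_succ_apply', Function.iterate_succ_apply']
      refine (hK _ _ t).trans ?_
      set c : ℝ := (1 / 2) ^ n * dist x y ^ p with hc
      have hc0 : 0 ≤ c := by positivity
      have hw := continuous_volterraWeight hg t₀
      have h1 : |∫ s in t₀..t, g s * ‖(K^[n]) x (projIcc a b hab s)
          - (K^[n]) y (projIcc a b hab s)‖ ^ p|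
          ≤ |∫ s in t₀..t, c * (g s * volterraWeight g t₀ s)| := by
        rw [← Real.norm_eq_abs]
        refine intervalIntegral.norm_integral_le_abs_of_norm_le ?_ ?_
        · refine (ae_restrict_mem measurableSet_uIoc).mono fun s hs => ?_
          have hs' : s ∈ Icc a b := (uIcc_subset_Icc ht₀ t.2) (uIoc_subset_uIcc hs)
          have h2 := ih x y ⟨s, hs'⟩
          rw [projIcc_of_mem hab hs', norm_mul, Real.norm_of_nonneg (hg0 s),
            Real.norm_of_nonneg (by positivity)]
          calc _ ≤ g s * (c * volterraWeight g t₀ s) := by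
                  gcongr
                  · exact hg0 s
            _ = _ := by ring
        · exact ((hg.intervalIntegrable).mul_continuousOn hw.continuousOn).const_mul c
      refine h1.trans ?_
      rw [intervalIntegral.integral_const_mul, abs_mul, abs_of_nonneg hc0]
      calc c * |∫ s in t₀..t, g s * volterraWeight g t₀ s|
          ≤ c * (volterraWeight g t₀ t / 2) := by
            gcongr; exact abs_integral_mul_volterraWeight_le hg hg0 t₀ t
        _ = _ := by rw [hc, pow_succ]; ring
  obtain ⟨W, hW⟩ := isCompact_Icc.exists_bound_of_continuousOn
    (continuous_volterraWeight hg t₀).continuousOn (s := Icc a b)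
  have hW0 : 0 ≤ W := (norm_nonneg _).trans (hW a ⟨le_rfl, hab⟩)
  obtain ⟨n, hn⟩ : ∃ n : ℕ, (1 / 2 : ℝ) ^ n < (1 / 2) ^ p / (W + 1) :=
    exists_pow_lt_of_lt_one (by positivity) (by norm_num)
  have hcontr : ContractingWith (1 / 2) K^[n] := by
    refine ⟨by rw [← NNReal.coe_lt_coe]; norm_num, LipschitzWith.of_dist_le_mul fun x y => ?_⟩
    rw [ContinuousMap.dist_le (by positivity)]
    intro t
    have h1 := main n x y t
    rw [dist_eq_norm]
    refine le_of_pow_le_pow_left₀ hp (by positivity) (h1.trans ?_)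
    have h2 : volterraWeight g t₀ t ≤ W + 1 :=
      ((Real.le_norm_self _).trans (hW t t.2)).trans (by linarith)
    rw [lt_div_iff₀ (by positivity)] at hn
    calc (1 / 2) ^ n * dist x y ^ p * volterraWeight g t₀ t
        ≤ (1 / 2) ^ n * dist x y ^ p * (W + 1) := by gcongr
      _ = ((1 / 2) ^ n * (W + 1)) * dist x y ^ p := by ring
      _ ≤ (1 / 2) ^ p * dist x y ^ p := by gcongr
      _ = _ := by rw [← mul_pow]; norm_num
  refine ⟨_, hcontr.isFixedPt_fixedPoint_iterate, fun y hy => ?_⟩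
  exact hcontr.fixedPoint_unique (Function.IsFixedPt.iterate hy n)

/-! ### Unitary propagators of integrable skew-adjoint families -/

section Propagator

variable {E : Type*} [NormedAddCommGroup E] [InnerProductSpace ℂ E]

/-- `A` is a family of bounded operators whose norms are dominated by the integrable function `g`,
regular enough for `s ↦ A s (x s)` to be integrable along every continuous curve `x`. -/
structure IsIntegrableFamily (A : ℝ → E →L[ℂ] E) (g : ℝ → ℝ) : Prop where
  integrable : Integrable g
  norm_le : ∀ s, ‖A s‖ ≤ g s
  measurable : ∀ x : ℝ → E, Continuous x → AEStronglyMeasurable (fun s => A s (x s)) volume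

/-- `y` is continuous on `[a, b]` and solves there `y(t) = f + ∫_{t₀}^t A(s) y(s) ds`, the integral
form of `y' = A(t) y`, `y(t₀) = f`. -/
structure IsSol (A : ℝ → E →L[ℂ] E) (a b t₀ : ℝ) (f : E) (y : ℝ → E) : Prop where
  continuousOn : ContinuousOn y (Icc a b)
  eq : ∀ t ∈ Icc a b, y t = f + ∫ s in t₀..t, A s (y s)

variable {A : ℝ → E →L[ℂ] E} {g : ℝ → ℝ} {a b : ℝ}

namespace IsIntegrableFamily

theorem nonneg (h : IsIntegrableFamily A g) (s : ℝ) : 0 ≤ g s :=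
  (norm_nonneg _).trans (h.norm_le s)

theorem intervalIntegrable (h : IsIntegrableFamily A g) {x : ℝ → E} (hx : Continuous x)
    (c d : ℝ) : IntervalIntegrable (fun s => A s (x s)) volume c d := by
  have h1 : IntervalIntegrable (fun s => g s * ‖x s‖) volume c d :=
    h.integrable.intervalIntegrable.mul_continuousOn hx.norm.continuousOn
  refine h1.mono_fun (h.measurable x hx).restrict (Eventually.of_forall fun s => ?_)
  simp only
  rw [Real.norm_of_nonneg (mul_nonneg (h.nonneg s) (norm_nonneg _))]
  exact (A s).le_of_opNorm_le (h.norm_le s) _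

theorem intervalIntegrable_of_continuousOn (h : IsIntegrableFamily A g) {x : ℝ → E}
    (hab : a ≤ b) (hx : ContinuousOn x (Icc a b)) {c d : ℝ} (hc : c ∈ Icc a b)
    (hd : d ∈ Icc a b) : IntervalIntegrable (fun s => A s (x s)) volume c d := by
  have h1 : Continuous (IccExtend hab ((Icc a b).domRestrict x)) :=
    (continuousOn_iff_continuous_domRestrict.1 hx).Icc_extend'
  refine (h.intervalIntegrable h1 c d).congr fun s hs => ?_
  rw [IccExtend_of_mem hab _ (uIcc_subset_Icc hc hd (uIoc_subset_uIcc hs)), domRestrict_apply]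

/-- Restarting a solution at another time. -/
theorem isSol_restart (h : IsIntegrableFamily A g) (hab : a ≤ b) {s r : ℝ} (hs : s ∈ Icc a b)
    (hr : r ∈ Icc a b) {f : E} {y : ℝ → E} (hy : IsSol A a b s f y) :
    IsSol A a b r (y r) y := by
  refine ⟨hy.1, fun t ht => ?_⟩
  rw [hy.2 t ht, hy.2 r hr, add_assoc, intervalIntegral.integral_add_adjacent_intervals
    (h.intervalIntegrable_of_continuousOn hab hy.1 hs hr)
    (h.intervalIntegrable_of_continuousOn hab hy.1 hr ht)]

variable [CompleteSpace E]

/-- The right-hand side of the integral equation, as a map of `C([a, b], E)`. -/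
def picardMap (h : IsIntegrableFamily A g) (hab : a ≤ b) (t₀ : ℝ) (f : E) (x : C(Icc a b, E)) :
    C(Icc a b, E) where
  toFun t := f + ∫ s in t₀..t, A s (x (projIcc a b hab s))
  continuous_toFun := by
    have : Continuous fun t => ∫ s in t₀..t, A s (x (projIcc a b hab s)) :=
      intervalIntegral.continuous_primitive
        (fun c d => h.intervalIntegrable (x.continuous.comp continuous_projIcc) c d) t₀
    fun_prop

theorem existsUnique_picardMap (h : IsIntegrableFamily A g) (hab : a ≤ b) {t₀ : ℝ}
    (ht₀ : t₀ ∈ Icc a b) (f : E) : ∃! x, h.picardMap hab t₀ f x = x := by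
  refine existsUnique_volterra hab ht₀ h.integrable h.nonneg one_ne_zero _ fun x y t => ?_
  have hx := h.intervalIntegrable (x.continuous.comp (continuous_projIcc (h := hab))) t₀ t
  have hy := h.intervalIntegrable (y.continuous.comp (continuous_projIcc (h := hab))) t₀ t
  simp only [Function.comp_apply] at hx hy
  simp only [pow_one, picardMap, ContinuousMap.coe_mk, add_sub_add_left_eq_sub]
  rw [← intervalIntegral.integral_sub hx hy]
  refine intervalIntegral.norm_integral_le_abs_of_norm_le (Eventually.of_forall fun s => ?_) ?_
  · rw [← map_sub]
    exact (A s).le_of_opNorm_le (h.norm_le s) _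
  · refine h.integrable.intervalIntegrable.mul_continuousOn (Continuous.continuousOn ?_)
    exact ((x.continuous.comp continuous_projIcc).sub (y.continuous.comp continuous_projIcc)).norm

theorem exists_isSol (h : IsIntegrableFamily A g) (hab : a ≤ b) {t₀ : ℝ} (ht₀ : t₀ ∈ Icc a b)
    (f : E) : ∃ y, IsSol A a b t₀ f y := by
  obtain ⟨x, hx, -⟩ := h.existsUnique_picardMap hab ht₀ f
  refine ⟨fun s => x (projIcc a b hab s),
    (x.continuous.comp continuous_projIcc).continuousOn, fun t ht => ?_⟩
  have h1 := congrArg (fun z : C(Icc a b, E) => z ⟨t, ht⟩) hx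
  simp only [projIcc_of_mem hab ht]
  exact h1.symm

theorem isSol_unique (h : IsIntegrableFamily A g) (hab : a ≤ b) {t₀ : ℝ} (ht₀ : t₀ ∈ Icc a b)
    {f : E} {y z : ℝ → E} (hy : IsSol A a b t₀ f y) (hz : IsSol A a b t₀ f z) :
    EqOn y z (Icc a b) := by
  have key : ∀ {y : ℝ → E} (hy : IsSol A a b t₀ f y),
      h.picardMap hab t₀ f ⟨(Icc a b).domRestrict y, continuousOn_iff_continuous_domRestrict.1 hy.1⟩
        = ⟨(Icc a b).domRestrict y, continuousOn_iff_continuous_domRestrict.1 hy.1⟩ := by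
    intro y hy
    ext t
    refine Eq.trans ?_ (hy.2 t t.2).symm
    simp only [picardMap, ContinuousMap.coe_mk]
    congr 1
    refine intervalIntegral.integral_congr fun s hs => ?_
    rw [projIcc_of_mem hab (uIcc_subset_Icc ht₀ t.2 hs)]
    rfl
  have h1 := (h.existsUnique_picardMap hab ht₀ f).unique (key hy) (key hz)
  intro t ht
  exact congrArg (fun z : C(Icc a b, E) => z ⟨t, ht⟩) h1

/-- If `A s` is skew then the norm is conserved: the squared norm of a solution is absolutely
continuous, with derivative `2 Re ⟪y, A y⟫ = 0` almost everywhere. -/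
theorem norm_isSol (h : IsIntegrableFamily A g) (hab : a ≤ b)
    (hskew : ∀ s x, (inner ℂ x (A s x)).re = 0) {t₀ : ℝ} (ht₀ : t₀ ∈ Icc a b) {f : E} {y : ℝ → E}
    (hy : IsSol A a b t₀ f y) {t : ℝ} (ht : t ∈ Icc a b) : ‖y t‖ = ‖f‖ := by
  obtain ⟨R, hR⟩ := isCompact_Icc.exists_bound_of_continuousOn hy.1
  have hR0 : 0 ≤ R := (norm_nonneg _).trans (hR a ⟨le_rfl, hab⟩)
  set z : ℝ → E := fun s => f + ∫ r in t₀..s, A r (y r) with hz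
  have hzy : ∀ s ∈ Icc a b, z s = y s := fun s hs => (hy.2 s hs).symm
  have hint : ∀ {c d : ℝ}, c ∈ Icc a b → d ∈ Icc a b →
      IntervalIntegrable (fun s => A s (y s)) volume c d :=
    fun hc hd => h.intervalIntegrable_of_continuousOn hab hy.1 hc hd
  have ha : a ∈ Icc a b := ⟨le_rfl, hab⟩
  have hb : b ∈ Icc a b := ⟨hab, le_rfl⟩
  have hU : AbsolutelyContinuousOnInterval (fun x => ∫ v in a..x, g v) a b :=
    h.integrable.intervalIntegrable.absolutelyContinuousOnInterval_intervalIntegral left_mem_uIcc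
  have hac : AbsolutelyContinuousOnInterval (fun s => ‖z s‖ ^ 2) a b := by
    refine absolutelyContinuousOnInterval_of_dist_le (C := 2 * R * R) (by positivity) hU ?_
    rw [uIcc_of_le hab]
    intro s hs r hr
    have h1 : ‖z s - z r‖ ≤ R * dist (∫ v in a..s, g v) (∫ v in a..r, g v) := by
      rw [hz]
      simp only [add_sub_add_left_eq_sub]
      rw [intervalIntegral.integral_interval_sub_left (hint ht₀ hs) (hint ht₀ hr), Real.dist_eq,
        intervalIntegral.integral_interval_sub_left h.integrable.intervalIntegrable
          h.integrable.intervalIntegrable, ← abs_of_nonneg hR0, ← abs_mul,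
        ← intervalIntegral.integral_const_mul]
      refine intervalIntegral.norm_integral_le_abs_of_norm_le ?_
        (h.integrable.intervalIntegrable.const_mul R)
      refine (ae_restrict_mem measurableSet_uIoc).mono fun v hv => ?_
      have hv' : v ∈ Icc a b := uIcc_subset_Icc hr hs (uIoc_subset_uIcc hv)
      calc ‖A v (y v)‖ ≤ g v * ‖y v‖ := (A v).le_of_opNorm_le (h.norm_le v) _
        _ ≤ g v * R := by gcongr; exacts [h.nonneg v, hR v hv']
        _ = R * g v := mul_comm _ _
    have h2 : ‖z s‖ ≤ R := by rw [hzy s hs]; exact hR s hs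
    have h3 : ‖z r‖ ≤ R := by rw [hzy r hr]; exact hR r hr
    have h4 : |‖z s‖ - ‖z r‖| ≤ ‖z s - z r‖ := abs_norm_sub_norm_le _ _
    rw [Real.dist_eq, sq_sub_sq, abs_mul, abs_of_nonneg (by positivity)]
    calc (‖z s‖ + ‖z r‖) * |‖z s‖ - ‖z r‖|
        ≤ (R + R) * (R * dist (∫ v in a..s, g v) (∫ v in a..r, g v)) := by
          gcongr; exact h4.trans h1
      _ = _ := by ring
  obtain ⟨C, hC⟩ := hac.const_of_ae_hasDerivAt_zero (by
    filter_upwards [(hint ha hb).ae_hasDerivAt_integral] with s hs hmem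
    have hs' : s ∈ Icc a b := by rwa [uIcc_of_le hab] at hmem
    have h1 : HasDerivAt z (A s (y s)) s :=
      (hs hmem t₀ (by rwa [uIcc_of_le hab])).const_add f
    let _ : InnerProductSpace ℝ E := InnerProductSpace.rclikeToReal ℂ E
    have h2 := h1.norm_sq
    have h3 : inner ℝ (z s) (A s (y s)) = 0 := by
      rw [real_inner_eq_re_inner ℂ, hzy s hs']
      exact hskew s (y s)
    rw [h3, mul_zero] at h2
    exact h2)
  rw [uIcc_of_le hab] at hC
  have h1 := (hC t ht).trans (hC t₀ ht₀).symm
  have h2 : z t₀ = f := by simp [hz]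
  rw [h2, hzy t ht] at h1
  exact (pow_left_inj₀ (norm_nonneg _) (norm_nonneg _) two_ne_zero).1 h1

/-- An integrable family of skew operators generates a strongly continuous unitary propagator. -/
theorem exists_unitary_propagator (h : IsIntegrableFamily A g) (hab : a ≤ b)
    (hskew : ∀ s x, (inner ℂ x (A s x)).re = 0) :
    ∃ Y : ℝ → ℝ → (E ≃ₗᵢ[ℂ] E),
      (∀ s ∈ Icc a b, ∀ f, IsSol A a b s f (fun t => Y t s f)) ∧
      (∀ t ∈ Icc a b, ∀ f, Y t t f = f) ∧
      (∀ t ∈ Icc a b, ∀ r ∈ Icc a b, ∀ s ∈ Icc a b, ∀ f, Y t r (Y r s f) = Y t s f) ∧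
      ∀ f, ContinuousOn (fun q : ℝ × ℝ => Y q.1 q.2 f) (Icc a b ×ˢ Icc a b) := by
  choose! sol hsol using fun (s : ℝ) (hs : s ∈ Icc a b) (f : E) => h.exists_isSol hab hs f
  have hrefl : ∀ t ∈ Icc a b, ∀ f, sol t f t = f := fun t ht f => by
    rw [(hsol t ht f).2 t ht]; simp
  have hcomp : ∀ t ∈ Icc a b, ∀ r ∈ Icc a b, ∀ s ∈ Icc a b, ∀ f,
      sol r (sol s f r) t = sol s f t := fun t ht r hr s hs f =>
    h.isSol_unique hab hr (hsol r hr _) (h.isSol_restart hab hs hr (hsol s hs f)) ht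
  have hadd : ∀ t ∈ Icc a b, ∀ s ∈ Icc a b, ∀ f f', sol s (f + f') t = sol s f t + sol s f' t := by
    intro t ht s hs f f'
    refine h.isSol_unique hab hs (hsol s hs _) (z := fun t => sol s f t + sol s f' t)
      ⟨(hsol s hs f).1.add (hsol s hs f').1, fun r hr => ?_⟩ ht
    simp only [map_add]
    rw [intervalIntegral.integral_add
      (h.intervalIntegrable_of_continuousOn hab (hsol s hs f).1 hs hr)
      (h.intervalIntegrable_of_continuousOn hab (hsol s hs f').1 hs hr)]
    nth_rewrite 1 [(hsol s hs f).2 r hr]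
    nth_rewrite 1 [(hsol s hs f').2 r hr]
    abel
  have hsmul : ∀ t ∈ Icc a b, ∀ s ∈ Icc a b, ∀ (c : ℂ) f, sol s (c • f) t = c • sol s f t := by
    intro t ht s hs c f
    refine h.isSol_unique hab hs (hsol s hs _) (z := fun t => c • sol s f t)
      ⟨(hsol s hs f).1.const_smul c, fun r hr => ?_⟩ ht
    simp only [map_smul]
    rw [intervalIntegral.integral_smul, ← smul_add, ← (hsol s hs f).2 r hr]
  let pr : ℝ → ℝ := fun t => projIcc a b hab t
  have hpr : ∀ t, pr t ∈ Icc a b := fun t => (projIcc a b hab t).2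
  have hpr' : ∀ t ∈ Icc a b, pr t = t := fun t ht => by simp only [pr, projIcc_of_mem hab ht]
  let Y : ℝ → ℝ → (E ≃ₗᵢ[ℂ] E) := fun t s =>
    { toFun := fun f => sol (pr s) f (pr t)
      invFun := fun f => sol (pr t) f (pr s)
      map_add' := hadd _ (hpr t) _ (hpr s)
      map_smul' := hsmul _ (hpr t) _ (hpr s)
      left_inv := fun f => by
        simp only
        rw [hcomp _ (hpr s) _ (hpr t) _ (hpr s), hrefl _ (hpr s)]
      right_inv := fun f => by
        simp only
        rw [hcomp _ (hpr t) _ (hpr s) _ (hpr t), hrefl _ (hpr t)]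
      norm_map' := fun f => h.norm_isSol hab hskew (hpr s) (hsol _ (hpr s) f) (hpr t) }
  have hY : ∀ t ∈ Icc a b, ∀ s ∈ Icc a b, ∀ f, Y t s f = sol s f t := fun t ht s hs f => by
    change sol (pr s) f (pr t) = _
    rw [hpr' t ht, hpr' s hs]
  have hYcomp : ∀ t ∈ Icc a b, ∀ r ∈ Icc a b, ∀ s ∈ Icc a b, ∀ f,
      Y t r (Y r s f) = Y t s f := fun t ht r hr s hs f => by
    rw [hY t ht r hr, hY r hr s hs, hY t ht s hs, hcomp t ht r hr s hs]
  have hYcont : ∀ s ∈ Icc a b, ∀ f, ContinuousOn (fun t => Y t s f) (Icc a b) := fun s hs f =>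
    (hsol s hs f).1.congr fun t ht => hY t ht s hs f
  refine ⟨Y, fun s hs f => ⟨hYcont s hs f, fun t ht => ?_⟩, fun t ht f => ?_, hYcomp, fun f => ?_⟩
  · rw [hY t ht s hs, (hsol s hs f).2 t ht]
    congr 1
    refine intervalIntegral.integral_congr fun r hr => ?_
    rw [hY r (uIcc_subset_Icc hs ht hr) s hs]
  · rw [hY t ht t ht, hrefl t ht]
  -- `Y t s = Y t r (Y s r)⁻¹`, and the inverse of a strongly continuous unitary family is strongly
  -- continuous.
  · rintro ⟨t₁, s₁⟩ ⟨ht₁, hs₁⟩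
    simp only at ht₁ hs₁
    have key : ∀ q ∈ Icc a b ×ˢ Icc a b, dist (Y q.1 q.2 f) (Y t₁ s₁ f)
        ≤ ‖Y q.2 s₁ f - f‖ + ‖Y q.1 s₁ f - Y t₁ s₁ f‖ := by
      rintro ⟨t, s⟩ ⟨ht, hs⟩
      simp only at ht hs ⊢
      have e1 : ‖Y t s f - Y t s₁ f‖ = ‖Y s s₁ f - f‖ := by
        rw [← hYcomp t ht s hs s₁ hs₁ f, ← map_sub, LinearIsometryEquiv.norm_map, norm_sub_rev]
      calc dist (Y t s f) (Y t₁ s₁ f) ≤ dist (Y t s f) (Y t s₁ f) + dist (Y t s₁ f) (Y t₁ s₁ f) :=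
            dist_triangle _ _ _
        _ = _ := by rw [dist_eq_norm, dist_eq_norm, e1]
    have hrefl' : Y s₁ s₁ f = f := by rw [hY s₁ hs₁ s₁ hs₁, hrefl s₁ hs₁]
    have l1 : Tendsto (fun q : ℝ × ℝ => ‖Y q.2 s₁ f - f‖)
        (𝓝[Icc a b ×ˢ Icc a b] (t₁, s₁)) (𝓝 0) := by
      have h1 : ContinuousOn (fun q : ℝ × ℝ => ‖Y q.2 s₁ f - f‖) (Icc a b ×ˢ Icc a b) :=
        (((hYcont s₁ hs₁ f).comp continuousOn_snd fun q hq => hq.2).sub continuousOn_const).norm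
      have h2 := h1 (t₁, s₁) ⟨ht₁, hs₁⟩
      simpa only [ContinuousWithinAt, hrefl', sub_self, norm_zero] using h2
    have l2 : Tendsto (fun q : ℝ × ℝ => ‖Y q.1 s₁ f - Y t₁ s₁ f‖)
        (𝓝[Icc a b ×ˢ Icc a b] (t₁, s₁)) (𝓝 0) := by
      have h1 : ContinuousOn (fun q : ℝ × ℝ => ‖Y q.1 s₁ f - Y t₁ s₁ f‖) (Icc a b ×ˢ Icc a b) :=
        (((hYcont s₁ hs₁ f).comp continuousOn_fst fun q hq => hq.1).sub continuousOn_const).norm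
      have h2 := h1 (t₁, s₁) ⟨ht₁, hs₁⟩
      simpa only [ContinuousWithinAt, sub_self, norm_zero] using h2
    rw [ContinuousWithinAt, tendsto_iff_dist_tendsto_zero]
    refine squeeze_zero' (Eventually.of_forall fun _ => dist_nonneg)
      (eventually_mem_nhdsWithin.mono key) ?_
    simpa using l1.add l2

end IsIntegrableFamily

end Propagator

/-! ### Functions with equal head and tail components -/

theorem measurePreserving_coe_Icc :
    MeasurePreserving ((↑) : ℝ → UnitAddCircle) (volume.restrict (Icc (0 : ℝ) 1)) volume := by
  have h := UnitAddCircle.measurePreserving_mk 0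
  rw [zero_add] at h
  rwa [← Measure.restrict_congr_set (Ioc_ae_eq_Icc (a := (0 : ℝ)) (b := 1) (μ := volume))]

theorem L2p_ext {f g : L2p} (h1 : f.fst = g.fst) (h2 : f.snd = g.snd) : f = g :=
  (WithLp.equiv 2 (Head × Tail)).injective (Prod.ext h1 h2)

/-- The restriction to the head of a function on the circle. -/
def restrictHead : Tail →ₗᵢ[ℂ] Head :=
  Lp.compMeasurePreservingₗᵢ ℂ ((↑) : ℝ → UnitAddCircle) measurePreserving_coe_Icc

theorem coeFn_restrictHead (g : Tail) :
    restrictHead g =ᵐ[volume.restrict (Icc (0 : ℝ) 1)] fun x => g (x : UnitAddCircle) :=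
  Lp.coeFn_compMeasurePreserving g measurePreserving_coe_Icc

/-- The element `(g, g)` of `L²_p` given by a function `g` on the circle. -/
def diag : Tail →L[ℂ] L2p :=
  (WithLp.prodContinuousLinearEquiv 2 ℂ Head Tail).symm.toContinuousLinearMap.comp
    (restrictHead.toContinuousLinearMap.prod (ContinuousLinearMap.id ℂ Tail))

theorem diag_fst (g : Tail) : (diag g).fst = restrictHead g := rfl

theorem diag_snd (g : Tail) : (diag g).snd = g := rfl

theorem inner_diag (f g : Tail) : inner ℂ (diag f) (diag g) = 2 * inner ℂ f g := by
  rw [WithLp.prod_inner_apply]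
  change inner ℂ (restrictHead f) (restrictHead g) + inner ℂ f g = _
  rw [LinearIsometry.inner_map_map, two_mul]

/-- The element `(e^{2πinx}, e^{2πinx})` of `L²_p`. -/
def expo (n : ℤ) : L2p := diag (ContinuousMap.toLp 2 volume ℂ (fourier n))

theorem inner_expo (m n : ℤ) : inner ℂ (expo m) (expo n) = if m = n then 2 else 0 := by
  -- the Fourier basis is stated for the Haar measure, which is propositionally equal to `volume`
  have h : ∀ ν : Measure UnitAddCircle, ν = AddCircle.haarAddCircle → ∀ _ : IsFiniteMeasure ν,
      inner ℂ (ContinuousMap.toLp 2 ν ℂ (fourier m) : Lp ℂ 2 ν)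
          (ContinuousMap.toLp 2 ν ℂ (fourier n))
        = if m = n then 1 else 0 := by
    rintro ν rfl _
    exact orthonormal_iff_ite.1 orthonormal_fourier m n
  rw [expo, expo, inner_diag, h volume (by
    rw [AddCircle.volume_eq_smul_haarAddCircle]; simp) inferInstance]
  split_ifs <;> simp

/-! ### The eigenfunctions -/

theorem φ_eq_diag (k : ℕ+) : φ k = diag ((memLp_profile_tail k).toLp _) := by
  refine L2p_ext ?_ rfl
  change (memLp_profile_head k).toLp _ = restrictHead _
  refine Lp.ext ?_
  filter_upwards [(memLp_profile_head k).coeFn_toLp, coeFn_restrictHead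
    ((memLp_profile_tail k).toLp _), measurePreserving_coe_Icc.quasiMeasurePreserving.ae_eq_comp
      (memLp_profile_tail k).coeFn_toLp] with x h1 h2 h3
  rw [h1, h2]
  simp only [Function.comp_apply] at h3
  rw [h3, profile_rep_coe]

theorem coe_rep (y : UnitAddCircle) : ((rep y : ℝ) : UnitAddCircle) = y :=
  (AddCircle.measurableEquivIco (1 : ℝ) 0).symm_apply_apply y

theorem φ_one : φ 1 = ((Real.sqrt 2 / 2 : ℝ) : ℂ) • expo 0 := by
  rw [φ_eq_diag, expo, ← map_smul]
  congr 1
  refine Lp.ext ?_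
  filter_upwards [(memLp_profile_tail 1).coeFn_toLp, Lp.coeFn_smul ((Real.sqrt 2 / 2 : ℝ) : ℂ)
    (ContinuousMap.toLp 2 volume ℂ (fourier 0) : Tail),
    ContinuousMap.coeFn_toLp (p := 2) (𝕜 := ℂ) (volume : Measure UnitAddCircle) (fourier 0)]
    with y h1 h2 h3
  rw [h1, h2, Pi.smul_apply, h3]
  simp [profile]

theorem φ_of_ne_one {k : ℕ+} (hk : k ≠ 1) :
    φ k = (1 / 2 : ℂ) • (expo ((k : ℤ) - 1) + expo (-((k : ℤ) - 1))) := by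
  rw [φ_eq_diag, expo, expo, ← map_add, ← map_smul]
  congr 1
  set n : ℤ := (k : ℤ) - 1 with hn
  refine Lp.ext ?_
  filter_upwards [(memLp_profile_tail k).coeFn_toLp, Lp.coeFn_smul (1 / 2 : ℂ)
    (ContinuousMap.toLp 2 volume ℂ (fourier n)
      + ContinuousMap.toLp 2 volume ℂ (fourier (-n)) : Tail),
    Lp.coeFn_add (ContinuousMap.toLp 2 volume ℂ (fourier n) : Tail)
      (ContinuousMap.toLp 2 volume ℂ (fourier (-n))),
    ContinuousMap.coeFn_toLp (p := 2) (𝕜 := ℂ) (volume : Measure UnitAddCircle) (fourier n),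
    ContinuousMap.coeFn_toLp (p := 2) (𝕜 := ℂ) (volume : Measure UnitAddCircle) (fourier (-n))]
    with y h1 h2 h3 h4 h5
  rw [h1, h2, Pi.smul_apply, h3, Pi.add_apply, h4, h5]
  conv_rhs => rw [← coe_rep y]
  rw [fourier_coe_apply, fourier_coe_apply, profile, if_neg hk, Complex.ofReal_cos, Complex.cos,
    smul_eq_mul, hn]
  push_cast
  simp only [div_one]
  ring_nf

theorem inner_φ_self (k : ℕ+) : inner ℂ (φ k) (φ k) = 1 := by
  by_cases hk : k = 1
  · subst hk
    rw [φ_one, inner_smul_left, inner_smul_right, inner_expo, if_pos rfl, Complex.conj_ofReal]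
    norm_cast
    have := Real.mul_self_sqrt (show (0 : ℝ) ≤ 2 by norm_num)
    linarith
  · have h1 : (k : ℤ) ≠ 1 := by exact_mod_cast fun h => hk (PNat.coe_eq_one_iff.1 h)
    have h2 : (k : ℤ) - 1 ≠ -((k : ℤ) - 1) := by omega
    rw [φ_of_ne_one hk, inner_smul_left, inner_smul_right, inner_add_left, inner_add_right,
      inner_add_right, inner_expo, inner_expo, inner_expo, inner_expo, if_pos rfl, if_pos rfl,
      if_neg h2, if_neg h2.symm]
    simp [Complex.conj_ofNat]; norm_num

/-- `φ_k` has no frequency other than `±(k-1)`. -/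
theorem inner_expo_φ (n : ℤ) (k : ℕ+) (h1 : n ≠ (k : ℤ) - 1) (h2 : -n ≠ (k : ℤ) - 1) :
    inner ℂ (expo n) (φ k) = 0 := by
  by_cases hk : k = 1
  · subst hk
    rw [φ_one, inner_smul_right, inner_expo, if_neg (by simpa using h1), mul_zero]
  · rw [φ_of_ne_one hk, inner_smul_right, inner_add_right, inner_expo, inner_expo, if_neg h1,
      if_neg (by omega)]
    simp

theorem orthonormal_φ : Orthonormal ℂ φ := by
  refine ⟨fun k => ?_, fun j k hjk => ?_⟩
  · rw [@norm_eq_sqrt_re_inner ℂ, inner_φ_self]; simp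
  · have h0 : (j : ℤ) ≠ k := by exact_mod_cast fun h => hjk (PNat.coe_injective h)
    change inner ℂ (φ j) (φ k) = 0
    have hj := j.pos
    have hk := k.pos
    by_cases h : j = 1
    · subst h
      rw [φ_one, inner_smul_left, inner_expo_φ, mul_zero] <;>
        simp only [PNat.one_coe, Nat.cast_one] at h0 <;> omega
    · rw [φ_of_ne_one h, inner_smul_left, inner_add_left, inner_expo_φ, inner_expo_φ] <;>
        first | omega | simp

/-- For `f ∈ ℋ(φ)`, the Fourier coefficients are even. -/
theorem inner_expo_neg {f : L2p} (hf : f ∈ Hφ) (n : ℤ) :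
    inner ℂ (expo (-n)) f = inner ℂ (expo n) f := by
  have hcl : IsClosed {f : L2p | inner ℂ (expo (-n)) f = inner ℂ (expo n) f} :=
    isClosed_eq (by fun_prop) (by fun_prop)
  refine closure_minimal ?_ hcl hf
  intro g hg
  induction hg using Submodule.span_induction with
  | mem x hx =>
    obtain ⟨k, rfl⟩ := hx
    by_cases h : k = 1
    · subst h
      simp only [mem_ofPred_eq, φ_one, inner_smul_right, inner_expo, neg_eq_zero]
    · simp only [mem_ofPred_eq, φ_of_ne_one h, inner_smul_right, inner_add_right, inner_expo]
      rw [add_comm]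
      simp only [neg_eq_iff_eq_neg, neg_neg]
  | zero => simp
  | add x y _ _ hx hy =>
    simp only [mem_ofPred_eq] at hx hy ⊢
    rw [inner_add_right, inner_add_right, hx, hy]
  | smul a x _ hx =>
    simp only [mem_ofPred_eq] at hx ⊢
    rw [inner_smul_right, inner_smul_right, hx]

theorem inner_φ_one (f : L2p) :
    inner ℂ (φ 1) f = ((Real.sqrt 2 / 2 : ℝ) : ℂ) * inner ℂ (expo 0) f := by
  rw [φ_one, inner_smul_left, Complex.conj_ofReal]

theorem inner_φ_of_ne_one {f : L2p} (hf : f ∈ Hφ) {k : ℕ+} (hk : k ≠ 1) :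
    inner ℂ (φ k) f = inner ℂ (expo ((k : ℤ) - 1)) f := by
  rw [φ_of_ne_one hk, inner_smul_left, inner_add_left, inner_expo_neg hf, map_div₀, map_one,
    Complex.conj_ofNat]
  ring

/-! ### The control operator -/

theorem coeFn_B_fst (f : L2p) : (B f).fst =ᵐ[volume.restrict (Icc (0 : ℝ) 1)]
    fun x => (V₁ x : ℂ) * f.fst x := (memLp_head_mul f.fst).coeFn_toLp

theorem coeFn_B_snd (f : L2p) : (B f).snd =ᵐ[volume] fun y => (V₂circle y : ℂ) * f.snd y :=
  (memLp_tail_mul f.snd).coeFn_toLp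

theorem norm_B_le (f : L2p) : ‖B f‖ ≤ ‖f‖ := by
  have h1 : ‖(B f).fst‖ ≤ ‖f.fst‖ := by
    refine Lp.norm_le_norm_of_ae_le ?_
    filter_upwards [coeFn_B_fst f, ae_restrict_mem measurableSet_Icc] with x h hx
    rw [h, norm_mul, Complex.norm_real, Real.norm_eq_abs]
    exact mul_le_of_le_one_left (norm_nonneg _) (abs_V₁_le hx.1 hx.2)
  have h2 : ‖(B f).snd‖ ≤ ‖f.snd‖ := by
    refine Lp.norm_le_norm_of_ae_le ?_
    filter_upwards [coeFn_B_snd f] with y h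
    rw [h, norm_mul, Complex.norm_real, Real.norm_eq_abs, V₂circle_eq]
    exact mul_le_of_le_one_left (norm_nonneg _) (abs_V₁_le (rep_mem y).1 (rep_mem y).2.le)
  rw [← sq_le_sq₀ (norm_nonneg _) (norm_nonneg _), WithLp.prod_norm_sq_eq_of_L2,
    WithLp.prod_norm_sq_eq_of_L2]
  gcongr

/-- `B` as a bounded operator. -/
def Bclm : L2p →L[ℂ] L2p :=
  LinearMap.mkContinuous
    { toFun := B
      map_add' := fun f g => by
        refine L2p_ext ?_ ?_
        · refine Lp.ext ?_
          filter_upwards [coeFn_B_fst (f + g), coeFn_B_fst f, coeFn_B_fst g,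
            Lp.coeFn_add (B f).fst (B g).fst, Lp.coeFn_add f.fst g.fst] with x h1 h2 h3 h4 h5
          rw [h1, WithLp.add_fst, WithLp.add_fst, h4, h5, Pi.add_apply, Pi.add_apply, h2, h3,
            mul_add]
        · refine Lp.ext ?_
          filter_upwards [coeFn_B_snd (f + g), coeFn_B_snd f, coeFn_B_snd g,
            Lp.coeFn_add (B f).snd (B g).snd, Lp.coeFn_add f.snd g.snd] with x h1 h2 h3 h4 h5
          rw [h1, WithLp.add_snd, WithLp.add_snd, h4, h5, Pi.add_apply, Pi.add_apply, h2, h3,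
            mul_add]
      map_smul' := fun c f => by
        refine L2p_ext ?_ ?_
        · refine Lp.ext ?_
          filter_upwards [coeFn_B_fst (c • f), coeFn_B_fst f,
            Lp.coeFn_smul c (B f).fst, Lp.coeFn_smul c f.fst] with x h1 h2 h3 h4
          rw [h1, RingHom.id_apply, WithLp.smul_fst, WithLp.smul_fst, h3, h4, Pi.smul_apply,
            Pi.smul_apply, h2, smul_eq_mul, smul_eq_mul]
          ring
        · refine Lp.ext ?_
          filter_upwards [coeFn_B_snd (c • f), coeFn_B_snd f,
            Lp.coeFn_smul c (B f).snd, Lp.coeFn_smul c f.snd] with x h1 h2 h3 h4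
          rw [h1, RingHom.id_apply, WithLp.smul_snd, WithLp.smul_snd, h3, h4, Pi.smul_apply,
            Pi.smul_apply, h2, smul_eq_mul, smul_eq_mul]
          ring }
    1 (fun f => by rw [one_mul]; exact norm_B_le f)

theorem Bclm_apply (f : L2p) : Bclm f = B f := rfl

theorem inner_B_left (f g : L2p) : inner ℂ (B f) g = inner ℂ f (B g) := by
  rw [WithLp.prod_inner_apply, WithLp.prod_inner_apply]
  change inner ℂ (B f).fst g.fst + inner ℂ (B f).snd g.snd
    = inner ℂ f.fst (B g).fst + inner ℂ f.snd (B g).snd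
  simp only [L2.inner_def]
  congr 1
  · refine integral_congr_ae ?_
    filter_upwards [coeFn_B_fst f, coeFn_B_fst g] with x h1 h2
    rw [h1, h2]
    simp only [RCLike.inner_apply', map_mul, Complex.conj_ofReal]
    ring
  · refine integral_congr_ae ?_
    filter_upwards [coeFn_B_snd f, coeFn_B_snd g] with x h1 h2
    rw [h1, h2]
    simp only [RCLike.inner_apply', map_mul, Complex.conj_ofReal]
    ring

/-- The Fourier coefficients of the potential `x²(x-1)² = B₄(x) + 1/30`, where `B₄` is the fourth
Bernoulli polynomial. The second summand vanishes for `n = 0`, by the convention `1 / 0 = 0`. -/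
def Vhat (n : ℤ) : ℂ := (if n = 0 then 1 / 30 else 0) - 3 / (2 * Real.pi ^ 4) * (1 / (n : ℂ) ^ 4)

theorem hasSum_Vhat (y : UnitAddCircle) :
    HasSum (fun n : ℤ => Vhat n * fourier n y) (V₂circle y : ℂ) := by
  have hx : rep y ∈ Icc (0 : ℝ) 1 := ⟨(rep_mem y).1, (rep_mem y).2.le⟩
  have h1 := hasSum_one_div_pow_mul_fourier_mul_bernoulliFun (k := 4) (by norm_num) hx
  rw [coe_rep] at h1
  have h2 := h1.mul_left (3 / (2 * (Real.pi : ℂ) ^ 4))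
  have h3 : HasSum (fun n : ℤ => if n = 0 then (1 / 30 : ℂ) else 0) (1 / 30) :=
    hasSum_ite_eq 0 _
  have h4 := h3.sub h2
  have hb : bernoulliFun 4 (rep y) = rep y ^ 4 - 2 * rep y ^ 3 + rep y ^ 2 - 1 / 30 := by
    have b2 : bernoulli 2 = 1 / 6 := by simp [bernoulli_eq_bernoulli'_of_ne_one]
    have b3 : bernoulli 3 = 0 := by simp [bernoulli_eq_bernoulli'_of_ne_one]
    have b4 : bernoulli 4 = -1 / 30 := by simp [bernoulli_eq_bernoulli'_of_ne_one]
    have c2 : Nat.choose 4 2 = 6 := rfl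
    have c3 : Nat.choose 4 3 = 4 := rfl
    simp only [bernoulliFun, Polynomial.bernoulli_def, Finset.sum_range_succ, Finset.range_zero,
      Finset.sum_empty, b2, b3, b4, c2, c3]
    simp
    ring
  have hpi : (Real.pi : ℂ) ≠ 0 := by exact_mod_cast Real.pi_ne_zero
  convert! h4 using 1
  · ext n
    unfold Vhat
    by_cases hn : n = 0
    · subst hn; simp
    · simp only [hn, if_false]; ring
  · rw [hb, V₂circle_eq, V₁]
    have hI : Complex.I ^ 4 = 1 := Complex.I_pow_four
    have hf : (Nat.factorial 4 : ℂ) = 24 := by norm_num [Nat.factorial]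
    rw [mul_pow, hI, hf]
    push_cast
    field_simp
    ring

theorem summable_Vhat : Summable fun n : ℤ => ‖Vhat n‖ := by
  have h1 : Summable fun n : ℤ => ‖(if n = 0 then (1 / 30 : ℂ) else 0)‖ :=
    summable_of_ne_finset_zero (s := {0}) fun n hn => by simp_all
  have h2 : Summable fun n : ℤ => ‖(3 / (2 * (Real.pi : ℂ) ^ 4)) * (1 / (n : ℂ) ^ 4)‖ := by
    simp only [norm_mul, norm_div, norm_one, norm_pow, Complex.norm_intCast]
    refine Summable.mul_left _ ?_
    refine (Real.summable_one_div_int_pow.2 (show 1 < 4 by norm_num)).congr fun n => ?_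
    rw [show (4 : ℕ) = 2 * 2 from rfl, pow_mul, pow_mul, sq_abs]
  exact (h1.add h2).of_nonneg_of_le (fun _ => norm_nonneg _) fun n => norm_sub_le _ _

/-- Multiplication by the potential is a convolution of Fourier coefficients. -/
theorem hasSum_B_expo (m : ℤ) : HasSum (fun n : ℤ => Vhat n • expo (m + n)) (B (expo m)) := by
  have hs : Summable fun n : ℤ => Vhat n • (fourier (m + n) : C(UnitAddCircle, ℂ)) := by
    refine Summable.of_norm ?_
    simpa only [norm_smul, fourier_norm, mul_one] using summable_Vhat
  obtain ⟨S, hS⟩ := hs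
  have hpt : ∀ y, S y = (V₂circle y : ℂ) * fourier m y := fun y => by
    have h1 := ContinuousMap.hasSum_apply hS y
    have h2 := (hasSum_Vhat y).mul_right (fourier m y)
    refine h1.unique ?_
    convert! h2 using 2 with n
    simp only [ContinuousMap.smul_apply, smul_eq_mul, fourier_add]
    ring
  have h1 := (hS.mapL (ContinuousMap.toLp (E := ℂ) 2 volume ℂ)).mapL diag
  simp only [map_smul] at h1
  have hB : B (expo m) = diag (ContinuousMap.toLp (E := ℂ) 2 volume ℂ S) := by
    have hS' := ContinuousMap.coeFn_toLp (p := 2) (𝕜 := ℂ) (volume : Measure UnitAddCircle) S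
    have hm := ContinuousMap.coeFn_toLp (p := 2) (𝕜 := ℂ) (volume : Measure UnitAddCircle)
      (fourier m)
    refine L2p_ext (Lp.ext ?_) (Lp.ext ?_)
    · have hq := measurePreserving_coe_Icc.quasiMeasurePreserving
      have hne : ∀ᵐ x : ℝ ∂(volume.restrict (Icc (0 : ℝ) 1)), x ≠ 1 :=
        ae_restrict_of_ae (by simp [ae_iff, measure_singleton])
      filter_upwards [coeFn_B_fst (expo m), coeFn_restrictHead (ContinuousMap.toLp 2 volume ℂ S),
        coeFn_restrictHead (ContinuousMap.toLp 2 volume ℂ (fourier m)), hq.ae_eq_comp hS',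
        hq.ae_eq_comp hm, ae_restrict_mem measurableSet_Icc, hne] with x h1 h2 h3 h4 h5 h6 h7
      simp only [Function.comp_apply] at h4 h5
      rw [h1, expo, diag_fst, h3, h5, diag_fst, h2, h4, hpt, V₂circle_eq, rep_coe,
        Int.fract_eq_self.2 ⟨h6.1, lt_of_le_of_ne h6.2 h7⟩]
    · filter_upwards [coeFn_B_snd (expo m), hS', hm] with y h1 h2 h3
      rw [h1, expo, diag_snd, diag_snd, h2, h3, hpt]
  rw [hB]
  exact h1

/-- The Fourier coefficients of `B f`. -/
theorem hasSum_inner_expo_B (f : L2p) (m : ℤ) :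
    HasSum (fun n : ℤ => Vhat n * inner ℂ (expo (m + n)) f) (inner ℂ (expo m) (B f)) := by
  have hreal : ∀ n, (starRingEnd ℂ) (Vhat n) = Vhat n := fun n => by
    rw [Vhat]
    split_ifs <;> simp [Complex.conj_ofNat]
  have h := (hasSum_B_expo m).mapL (innerSL ℂ f)
  have h2 := Complex.hasSum_conj'.2 h
  simp only [innerSL_apply_apply, inner_smul_right] at h2
  rw [← inner_B_left]
  convert! h2 using 1
  · ext n; rw [map_mul, hreal, inner_conj_symm]
  · rw [inner_conj_symm]

theorem isClosed_Hφ : IsClosed (Hφ : Set L2p) := Submodule.isClosed_topologicalClosure _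

theorem φ_mem (k : ℕ+) : φ k ∈ Hφ :=
  Submodule.le_topologicalClosure _ (Submodule.subset_span ⟨k, rfl⟩)

/-- `ℋ(φ)` contains all the even combinations of exponentials. -/
theorem expo_add_expo_neg_mem (n : ℤ) : expo n + expo (-n) ∈ Hφ := by
  wlog hn : 0 ≤ n
  · have := this (-n) (by omega)
    rwa [neg_neg, add_comm] at this
  rcases hn.eq_or_lt with rfl | hn
  · have h2 : ((Real.sqrt 2 / 2 : ℝ) : ℂ) ≠ 0 := by
      have : (0 : ℝ) < Real.sqrt 2 / 2 := by positivity
      exact_mod_cast this.ne'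
    have h3 : expo 0 = (((Real.sqrt 2 / 2 : ℝ) : ℂ))⁻¹ • φ 1 := by
      rw [φ_one, smul_smul, inv_mul_cancel₀ h2, one_smul]
    rw [neg_zero]
    have := Hφ.smul_mem (((Real.sqrt 2 / 2 : ℝ) : ℂ))⁻¹ (φ_mem 1)
    rw [← h3] at this
    exact Hφ.add_mem this this
  · obtain ⟨k, rfl⟩ := Int.eq_ofNat_of_zero_le hn.le
    have hk : k.succPNat ≠ 1 := by
      intro h
      have := congrArg PNat.val h
      simp at this
      omega
    have h := Hφ.smul_mem 2 (φ_mem k.succPNat)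
    rw [φ_of_ne_one hk, smul_smul] at h
    norm_num at h
    simpa using h

theorem B_expo_add_B_expo_neg_mem (m : ℤ) : B (expo m) + B (expo (-m)) ∈ Hφ := by
  have hV : ∀ n, Vhat (-n) = Vhat n := fun n => by
    rw [Vhat, Vhat]; simp [Even.neg_pow (show Even 4 by decide)]
  have h2 : HasSum (fun n : ℤ => Vhat n • expo (-(m + n))) (B (expo (-m))) := by
    have h := (Equiv.neg ℤ).hasSum_iff.2 (hasSum_B_expo (-m))
    refine h.congr_fun fun n => ?_
    rw [Function.comp_apply, Equiv.neg_apply, hV, ← neg_add]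
  have h3 : ∀ n : ℤ, Vhat n • expo (m + n) + Vhat n • expo (-(m + n)) ∈ Hφ := fun n => by
    rw [← smul_add]
    exact Hφ.smul_mem _ (expo_add_expo_neg_mem _)
  exact isClosed_Hφ.mem_of_tendsto ((hasSum_B_expo m).add h2)
    (Eventually.of_forall fun s => Hφ.sum_mem fun n _ => h3 n)

theorem Bclm_φ_mem (k : ℕ+) : Bclm (φ k) ∈ Hφ := by
  by_cases h : k = 1
  · subst h
    have h1 := Hφ.smul_mem (1 / 2 : ℂ) (B_expo_add_B_expo_neg_mem 0)
    rw [neg_zero, ← two_smul ℂ, smul_smul, one_div_mul_cancel two_ne_zero, one_smul] at h1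
    rw [φ_one, map_smul]
    exact Hφ.smul_mem _ h1
  · rw [φ_of_ne_one h, map_smul, map_add]
    exact Hφ.smul_mem _ (B_expo_add_B_expo_neg_mem _)

theorem map_mem_closure_span {E : Type*} [NormedAddCommGroup E] [NormedSpace ℂ E] (L : E →L[ℂ] E)
    {S : Set E} (h : ∀ x ∈ S, L x ∈ (Submodule.span ℂ S).topologicalClosure) {f : E}
    (hf : f ∈ (Submodule.span ℂ S).topologicalClosure) :
    L f ∈ (Submodule.span ℂ S).topologicalClosure := by
  have h1 : Submodule.span ℂ S
      ≤ (Submodule.span ℂ S).topologicalClosure.comap (L : E →ₗ[ℂ] E) := Submodule.span_le.2 h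
  exact Submodule.topologicalClosure_minimal _ h1
    ((Submodule.isClosed_topologicalClosure _).preimage L.continuous) hf

theorem Bclm_mem_Hφ {f : L2p} (hf : f ∈ Hφ) : Bclm f ∈ Hφ := by
  unfold Hφ at hf ⊢
  refine map_mem_closure_span Bclm ?_ hf
  rintro _ ⟨k, rfl⟩
  exact Bclm_φ_mem k

theorem B_mem_Hφ {f : L2p} (hf : f ∈ Hφ) : B f ∈ Hφ := by
  rw [← Bclm_apply]
  exact Bclm_mem_Hφ hf

/-! ### The eigenvalue equation -/

theorem ae_coe_circle {P : UnitAddCircle → Prop} (h : ∀ᵐ y, P y) :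
    ∀ᵐ x : ℝ, P (x : UnitAddCircle) := by
  have h1 : ∀ n : ℤ, ∀ᵐ x : ℝ ∂(volume.restrict (Ioc (n : ℝ) (n + 1))), P (x : UnitAddCircle) :=
    fun n => (UnitAddCircle.measurePreserving_mk n).quasiMeasurePreserving.ae h
  have h2 := (ae_restrict_iUnion_iff (μ := volume) (fun n : ℤ => Ioc (n : ℝ) (n + 1))
    (fun x : ℝ => P (x : UnitAddCircle))).2 h1
  rwa [iUnion_Ioc_intCast, Measure.restrict_univ] at h2

/-- The derivative of `profile k`. -/
def profileDeriv (k : ℕ+) (x : ℝ) : ℂ :=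
  ((-(2 * ((k : ℝ) - 1) * Real.pi * Real.sin (2 * ((k : ℝ) - 1) * Real.pi * x)) : ℝ) : ℂ)

theorem hasDerivAt_profile (k : ℕ+) (x : ℝ) : HasDerivAt (profile k) (profileDeriv k x) x := by
  by_cases hk : k = 1
  · have h1 : profile k = fun _ => ((Real.sqrt 2 / 2 : ℝ) : ℂ) := by
      ext x; simp [profile, hk]
    have h2 : profileDeriv k x = 0 := by simp [profileDeriv, hk]
    rw [h1, h2]
    exact hasDerivAt_const _ _
  · have h1 : profile k = fun x => ((Real.cos (2 * ((k : ℝ) - 1) * Real.pi * x) : ℝ) : ℂ) := by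
      ext x; simp [profile, hk]
    rw [h1]
    refine HasDerivAt.ofReal_comp ?_
    convert! ((hasDerivAt_id x).const_mul (2 * ((k : ℝ) - 1) * Real.pi)).cos using 1
    simp; ring

theorem hasDerivAt_profileDeriv (k : ℕ+) (x : ℝ) :
    HasDerivAt (profileDeriv k) (-((μ k : ℂ) * profile k x)) x := by
  have h : HasDerivAt (profileDeriv k) (((-(2 * ((k : ℝ) - 1) * Real.pi) ^ 2
      * Real.cos (2 * ((k : ℝ) - 1) * Real.pi * x) : ℝ)) : ℂ) x := by
    unfold profileDeriv
    refine HasDerivAt.ofReal_comp ?_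
    convert! (((hasDerivAt_id x).const_mul (2 * ((k : ℝ) - 1) * Real.pi)).sin.const_mul
      (2 * ((k : ℝ) - 1) * Real.pi)).neg using 1
    simp; ring
  convert h using 1
  by_cases hk : k = 1
  · simp [μ, hk]
  · simp only [μ, profile, hk, if_false]
    push_cast; ring

theorem integral_eigen {k : ℕ+} {x : ℝ} {h : ℝ → ℂ}
    (hh : ∀ᵐ y, y ∈ uIoc 0 x → h y = (μ k : ℂ) * profile k y) :
    profileDeriv k x = profileDeriv k 0 - ∫ y in (0 : ℝ)..x, h y := by
  have hc := continuous_profile k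
  rw [intervalIntegral.integral_congr_ae hh]
  have h1 := intervalIntegral.integral_eq_sub_of_hasDerivAt (a := 0) (b := x)
    (fun y _ => hasDerivAt_profileDeriv k y) (Continuous.intervalIntegrable (by fun_prop) _ _)
  rw [intervalIntegral.integral_neg] at h1
  linear_combination -h1

theorem isLaplacian_φ (k : ℕ+) : IsLaplacian (φ k) ((μ k : ℂ) • φ k) := by
  have hh : ∀ᵐ x : ℝ ∂(volume.restrict (Icc (0 : ℝ) 1)), (φ k).fst x = profile k x :=
    (memLp_profile_head k).coeFn_toLp
  have ht : ∀ᵐ x : ℝ, (φ k).snd (x : UnitAddCircle) = profile k x := by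
    filter_upwards [ae_coe_circle (memLp_profile_tail k).coeFn_toLp] with x hx
    rw [← profile_rep_coe]
    exact hx
  refine ⟨profile k, profileDeriv k, profile k, profileDeriv k, hh,
    fun x _ => (hasDerivAt_profile k x).hasDerivWithinAt, fun x hx => integral_eigen ?_,
    ae_restrict_of_ae ht, fun x _ => (hasDerivAt_profile k x).hasDerivWithinAt,
    fun x _ => integral_eigen ?_, ?_, rfl, ?_⟩
  · have h1 := Lp.coeFn_smul (μ k : ℂ) (φ k).fst
    rw [Filter.EventuallyEq, ae_restrict_iff' measurableSet_Icc] at h1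
    rw [ae_restrict_iff' measurableSet_Icc] at hh
    filter_upwards [h1, hh] with y h1 h2 hy
    rw [uIoc_of_le hx.1] at hy
    have hy' : y ∈ Icc (0 : ℝ) 1 := ⟨hy.1.le, hy.2.trans hx.2⟩
    rw [WithLp.smul_fst, h1 hy', Pi.smul_apply, h2 hy', smul_eq_mul]
  · filter_upwards [ae_coe_circle (Lp.coeFn_smul (μ k : ℂ) (φ k).snd), ht] with y h1 h2 _
    rw [WithLp.smul_snd, h1, Pi.smul_apply, h2, smul_eq_mul]
  · have := profile_add_one k 0
    rwa [zero_add, eq_comm] at this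
  · have h0 : profileDeriv k 0 = 0 := by simp [profileDeriv]
    have h1 : profileDeriv k 1 = 0 := by
      have e : 2 * ((k : ℝ) - 1) * Real.pi * 1 = ((2 * ((k : ℤ) - 1) : ℤ) : ℝ) * Real.pi := by
        push_cast; ring
      rw [profileDeriv, e, Real.sin_int_mul_pi]
      simp
    rw [h0, h1]; simp

/-! ### The free flow and the interaction picture -/

theorem continuousOn_isometry_apply {α E : Type*} [TopologicalSpace α] [NormedAddCommGroup E]
    [InnerProductSpace ℂ E] {L : α → (E ≃ₗᵢ[ℂ] E)} {S : Set α} {x : α → E}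
    (hL : ∀ f, ContinuousOn (fun q => L q f) S) (hx : ContinuousOn x S) :
    ContinuousOn (fun q => L q (x q)) S := by
  intro q₀ hq₀
  have h1 : Tendsto (fun q => L q (x q₀)) (𝓝[S] q₀) (𝓝 (L q₀ (x q₀))) := hL _ q₀ hq₀
  have h2 : Tendsto (fun q => ‖x q - x q₀‖) (𝓝[S] q₀) (𝓝 0) :=
    tendsto_iff_norm_sub_tendsto_zero.1 (hx q₀ hq₀)
  have h3 : Tendsto (fun q => L q (x q - x q₀)) (𝓝[S] q₀) (𝓝 0) := by
    rw [tendsto_zero_iff_norm_tendsto_zero]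
    simpa only [LinearIsometryEquiv.norm_map] using h2
  have h4 := h3.add h1
  rw [zero_add] at h4
  refine h4.congr fun q => ?_
  rw [← map_add, sub_add_cancel]

section Flow

variable {ι : Type*}

/-- `e^{-iνt}`. -/
def phase (ν t : ℝ) : ℂ := Complex.exp (-Complex.I * (ν : ℂ) * (t : ℂ))

theorem norm_phase (ν t : ℝ) : ‖phase ν t‖ = 1 := by
  rw [phase, show -Complex.I * (ν : ℂ) * (t : ℂ) = ((-(ν * t) : ℝ) : ℂ) * Complex.I by
    push_cast; ring]
  exact Complex.norm_exp_ofReal_mul_I _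

theorem phase_zero (ν : ℝ) : phase ν 0 = 1 := by simp [phase]

theorem phase_add (ν s t : ℝ) : phase ν (s + t) = phase ν s * phase ν t := by
  rw [phase, phase, phase, ← Complex.exp_add]
  push_cast; ring_nf

theorem continuous_phase (ν : ℝ) : Continuous (phase ν) := by
  unfold phase; fun_prop

theorem norm_sq_eq_tsum (a : ℓ²(ι, ℂ)) : ‖a‖ ^ 2 = ∑' i, ‖a i‖ ^ 2 := by
  have h := lp.norm_rpow_eq_tsum (p := 2) (by norm_num) a
  simp only [ENNReal.toReal_ofNat] at h
  exact_mod_cast h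

theorem summable_norm_sq (a : ℓ²(ι, ℂ)) : Summable fun i => ‖a i‖ ^ 2 := by
  have h := (lp.memℓp a).summable (p := 2) (by norm_num)
  simp only [ENNReal.toReal_ofNat] at h
  exact_mod_cast h

theorem memℓp_of_summable {a : ι → ℂ} (h : Summable fun i => ‖a i‖ ^ 2) : Memℓp a 2 := by
  refine memℓp_gen ?_
  simp only [ENNReal.toReal_ofNat]
  exact_mod_cast h

theorem memℓp_mul_of_norm_eq_one {c : ι → ℂ} (hc : ∀ i, ‖c i‖ = 1) (a : ℓ²(ι, ℂ)) :
    Memℓp (fun i => c i * a i) 2 := by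
  refine memℓp_of_summable ((summable_norm_sq a).congr fun i => ?_)
  rw [norm_mul, hc, one_mul]

/-- The diagonal unitary group `(a_i) ↦ (e^{-iν_i t} a_i)` of `ℓ²`. -/
def phaseFlow (ν : ι → ℝ) (t : ℝ) : ℓ²(ι, ℂ) ≃ₗᵢ[ℂ] ℓ²(ι, ℂ) where
  toFun a := ⟨fun i => phase (ν i) t * a i, memℓp_mul_of_norm_eq_one (fun i => norm_phase _ _) a⟩
  invFun a :=
    ⟨fun i => phase (ν i) (-t) * a i, memℓp_mul_of_norm_eq_one (fun i => norm_phase _ _) a⟩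
  map_add' a b := by ext i; exact mul_add _ _ _
  map_smul' c a := by ext i; exact mul_left_comm _ _ _
  left_inv a := by
    ext i
    change phase (ν i) (-t) * (phase (ν i) t * a i) = a i
    rw [← mul_assoc, ← phase_add, neg_add_cancel, phase_zero, one_mul]
  right_inv a := by
    ext i
    change phase (ν i) t * (phase (ν i) (-t) * a i) = a i
    rw [← mul_assoc, ← phase_add, add_neg_cancel, phase_zero, one_mul]
  norm_map' a := by
    change ‖(⟨fun i => phase (ν i) t * a i, _⟩ : ℓ²(ι, ℂ))‖ = ‖a‖
    rw [lp.norm_eq_tsum_rpow (by norm_num), lp.norm_eq_tsum_rpow (by norm_num)]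
    congr 1
    refine tsum_congr fun i => ?_
    change ‖phase (ν i) t * a i‖ ^ _ = _
    rw [norm_mul, norm_phase, one_mul]

theorem phaseFlow_apply (ν : ι → ℝ) (t : ℝ) (a : ℓ²(ι, ℂ)) (i : ι) :
    phaseFlow ν t a i = phase (ν i) t * a i := rfl

theorem continuous_phaseFlow (ν : ι → ℝ) (a : ℓ²(ι, ℂ)) : Continuous fun t => phaseFlow ν t a := by
  rw [continuous_iff_continuousAt]
  intro t₀
  have h1 : Continuous fun t => ∑' i, ‖phase (ν i) t * a i - phase (ν i) t₀ * a i‖ ^ 2 := by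
    refine continuous_tsum (u := fun i => 4 * ‖a i‖ ^ 2) (fun i => ?_)
      ((summable_norm_sq a).mul_left 4) fun i t => ?_
    · have := continuous_phase (ν i)
      fun_prop
    · have h2 : ‖phase (ν i) t * a i - phase (ν i) t₀ * a i‖ ≤ 2 * ‖a i‖ := by
        refine (norm_sub_le _ _).trans ?_
        rw [norm_mul, norm_mul, norm_phase, norm_phase]
        linarith
      rw [norm_pow, norm_norm]
      calc _ ≤ (2 * ‖a i‖) ^ 2 := by gcongr
        _ = _ := by ring
  have h2 := h1.tendsto t₀
  simp only [sub_self, norm_zero, ne_eq, OfNat.ofNat_ne_zero, not_false_eq_true, zero_pow,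
    tsum_zero] at h2
  rw [ContinuousAt, tendsto_iff_norm_sub_tendsto_zero]
  have h3 := h2.sqrt
  rw [Real.sqrt_zero] at h3
  refine h3.congr fun t => ?_
  rw [← Real.sqrt_sq (norm_nonneg (phaseFlow ν t a - phaseFlow ν t₀ a)), norm_sq_eq_tsum]
  rfl

variable {H : Type*} [NormedAddCommGroup H] [InnerProductSpace ℂ H]

/-- The unitary group `e^{-itA}` of the operator `A` with eigenbasis `b` and eigenvalues `ν`. -/
def flow (b : HilbertBasis ι ℂ H) (ν : ι → ℝ) (t : ℝ) : H ≃ₗᵢ[ℂ] H :=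
  (b.repr.trans (phaseFlow ν t)).trans b.repr.symm

variable (b : HilbertBasis ι ℂ H) (ν : ι → ℝ)

theorem repr_flow (t : ℝ) (f : H) : b.repr (flow b ν t f) = phaseFlow ν t (b.repr f) :=
  b.repr.apply_symm_apply _

theorem flow_add (s t : ℝ) (f : H) : flow b ν (s + t) f = flow b ν s (flow b ν t f) := by
  apply b.repr.injective
  ext i
  rw [repr_flow, repr_flow, repr_flow, phaseFlow_apply, phaseFlow_apply, phaseFlow_apply,
    phase_add, mul_assoc]

theorem flow_zero (f : H) : flow b ν 0 f = f := by
  apply b.repr.injective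
  ext i
  rw [repr_flow, phaseFlow_apply, phase_zero, one_mul]

theorem flow_flow_neg (t : ℝ) (f : H) : flow b ν t (flow b ν (-t) f) = f := by
  rw [← flow_add, add_neg_cancel, flow_zero]

theorem flow_neg_flow (t : ℝ) (f : H) : flow b ν (-t) (flow b ν t f) = f := by
  rw [← flow_add, neg_add_cancel, flow_zero]

theorem continuous_flow (f : H) : Continuous fun t => flow b ν t f :=
  b.repr.symm.continuous.comp (continuous_phaseFlow ν _)

theorem continuous_flow_apply {x : ℝ → H} (hx : Continuous x) {c : ℝ → ℝ} (hc : Continuous c) :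
    Continuous fun t => flow b ν (c t) (x t) := by
  rw [← continuousOn_univ]
  exact continuousOn_isometry_apply
    (fun f => ((continuous_flow b ν f).comp hc).continuousOn) hx.continuousOn

/-- The generator `-i u(s) e^{isA} C e^{-isA}` in the interaction picture. -/
def interaction (C : H →L[ℂ] H) (u : ℝ → ℝ) (s : ℝ) : H →L[ℂ] H :=
  (-Complex.I * (u s : ℂ)) •
    ((flow b ν (-s)).toContinuousLinearEquiv.toContinuousLinearMap.comp
      (C.comp (flow b ν s).toContinuousLinearEquiv.toContinuousLinearMap))

theorem interaction_apply (C : H →L[ℂ] H) (u : ℝ → ℝ) (s : ℝ) (f : H) :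
    interaction b ν C u s f
      = (-Complex.I * (u s : ℂ)) • flow b ν (-s) (C (flow b ν s f)) := rfl

theorem isIntegrableFamily_interaction (C : H →L[ℂ] H) {u : ℝ → ℝ} (hu : Integrable u) :
    IsIntegrableFamily (interaction b ν C u) (fun s => ‖C‖ * |u s|) where
  integrable := hu.abs.const_mul _
  norm_le s := by
    refine ContinuousLinearMap.opNorm_le_bound _ (by positivity) fun f => ?_
    rw [interaction_apply, norm_smul, LinearIsometryEquiv.norm_map, norm_mul, norm_neg,
      Complex.norm_I, one_mul, Complex.norm_real, Real.norm_eq_abs]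
    have h := C.le_opNorm (flow b ν s f)
    rw [LinearIsometryEquiv.norm_map] at h
    calc |u s| * ‖C (flow b ν s f)‖ ≤ |u s| * (‖C‖ * ‖f‖) := by gcongr
      _ = _ := by ring
  measurable x hx := by
    have h1 : Continuous fun s => flow b ν (-s) (C (flow b ν s (x s))) :=
      continuous_flow_apply b ν (C.continuous.comp (continuous_flow_apply b ν hx continuous_id))
        continuous_neg
    exact ((Complex.continuous_ofReal.comp_aestronglyMeasurable hu.1).const_mul _).smul
      h1.aestronglyMeasurable

theorem re_inner_interaction {C : H →L[ℂ] H} (hC : ∀ f g, inner ℂ (C f) g = inner ℂ f (C g))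
    (u : ℝ → ℝ) (s : ℝ) (f : H) : (inner ℂ f (interaction b ν C u s f)).re = 0 := by
  rw [interaction_apply, inner_smul_right]
  have h1 : inner ℂ f (flow b ν (-s) (C (flow b ν s f)))
      = inner ℂ (flow b ν s f) (C (flow b ν s f)) := by
    nth_rewrite 1 [← flow_neg_flow b ν s f]
    exact LinearIsometryEquiv.inner_map_map _ _ _
  have h2 : (inner ℂ (flow b ν s f) (C (flow b ν s f))).im = 0 := by
    have h3 := inner_conj_symm (𝕜 := ℂ) (flow b ν s f) (C (flow b ν s f))
    rw [hC] at h3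
    exact Complex.conj_eq_iff_im.1 h3
  rw [h1]
  simp [h2]

variable [CompleteSpace H]

/-- The passage to the interaction picture `y(t) = e^{itA} ψ(t)`: Duhamel's formula for `ψ` at time
`t` is the integral equation for `y` at time `t`. -/
theorem duhamel_iff (C : H →L[ℂ] H) {u : ℝ → ℝ} (hu : Integrable u) {a T : ℝ} (haT : a ≤ T)
    {ψ : ℝ → H} (hψ : ContinuousOn ψ (Icc a T)) (f : H) {t : ℝ} (ht : t ∈ Icc a T) :
    IntervalIntegrable (fun s => (u s : ℂ) • flow b ν (t - s) (C (ψ s))) volume a t ∧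
    (ψ t = flow b ν (t - a) f
        - Complex.I • ∫ s in a..t, (u s : ℂ) • flow b ν (t - s) (C (ψ s)) ↔
      flow b ν (-t) (ψ t) = flow b ν (-a) f
        + ∫ s in a..t, interaction b ν C u s (flow b ν (-s) (ψ s))) := by
  have hy : ContinuousOn (fun s => flow b ν (-s) (ψ s)) (Icc a T) :=
    continuousOn_isometry_apply
      (fun f => ((continuous_flow b ν f).comp continuous_neg).continuousOn) hψ
  have hint := (isIntegrableFamily_interaction b ν C hu).intervalIntegrable_of_continuousOn haT hy
    ⟨le_rfl, haT⟩ ht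
  have e : (fun s => (u s : ℂ) • flow b ν (t - s) (C (ψ s)))
      = fun s => Complex.I • (flow b ν t).toContinuousLinearEquiv.toContinuousLinearMap
        (interaction b ν C u s (flow b ν (-s) (ψ s))) := by
    ext s
    change _ = Complex.I • flow b ν t (interaction b ν C u s (flow b ν (-s) (ψ s)))
    rw [interaction_apply, flow_flow_neg, map_smul, smul_smul, sub_eq_add_neg, flow_add,
      ← mul_assoc, mul_neg, Complex.I_mul_I, neg_neg, one_mul]
  rw [e]
  refine ⟨⟨((flow b ν t).toContinuousLinearEquiv.toContinuousLinearMap.integrable_comp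
    hint.1).smul _, ((flow b ν t).toContinuousLinearEquiv.toContinuousLinearMap.integrable_comp
    hint.2).smul _⟩, ?_⟩
  rw [intervalIntegral.integral_smul, ContinuousLinearMap.intervalIntegral_comp_comm _ hint,
    smul_smul, Complex.I_mul_I, neg_one_smul, sub_neg_eq_add]
  change ψ t = flow b ν (t - a) f + flow b ν t _ ↔ _
  rw [sub_eq_add_neg t a, flow_add, ← map_add]
  constructor
  · intro h
    rw [h, flow_neg_flow]
  · intro h
    rw [← h, flow_flow_neg]

end Flow

/-! ### The unitary propagator on `ℋ(φ)` -/

instance : CompleteSpace Hφ := isClosed_Hφ.completeSpace_coe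

theorem eq_zero_of_inner_φ {f : L2p} (hf : f ∈ Hφ) (h : ∀ k, inner ℂ (φ k) f = 0) : f = 0 := by
  have h1 : Submodule.span ℂ (range φ) ≤ (ℂ ∙ f)ᗮ := by
    rw [Submodule.span_le]
    rintro _ ⟨k, rfl⟩
    exact Submodule.mem_orthogonal_singleton_iff_inner_left.2 (h k)
  have h2 : Hφ ≤ (ℂ ∙ f)ᗮ :=
    Submodule.topologicalClosure_minimal _ h1 (Submodule.isClosed_orthogonal _)
  exact inner_self_eq_zero.1 (Submodule.mem_orthogonal_singleton_iff_inner_left.1 (h2 hf))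

/-- The `φ_k` as a Hilbert basis of `ℋ(φ)`. -/
def basisφ : HilbertBasis ℕ+ ℂ Hφ :=
  HilbertBasis.mkOfOrthogonalEqBot (v := fun k => (⟨φ k, φ_mem k⟩ : Hφ))
    (by
      rw [orthonormal_iff_ite]
      exact orthonormal_iff_ite.1 orthonormal_φ)
    (by
      rw [Submodule.eq_bot_iff]
      intro f hf
      refine Subtype.ext (eq_zero_of_inner_φ f.2 fun k => ?_)
      exact (Submodule.mem_orthogonal _ _).1 hf _ (Submodule.subset_span ⟨k, rfl⟩))

theorem coe_basisφ (k : ℕ+) : (basisφ k : L2p) = φ k := by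
  rw [basisφ, HilbertBasis.coe_mkOfOrthogonalEqBot]

theorem repr_basisφ (f : Hφ) (k : ℕ+) : basisφ.repr f k = inner ℂ (φ k) (f : L2p) := by
  rw [HilbertBasis.repr_apply_apply, Submodule.coe_inner, coe_basisφ]

theorem freeFlow_coe (t : ℝ) (f : Hφ) : freeFlow t f = (flow basisφ μ t f : L2p) := by
  have h := (basisφ.hasSum_repr (flow basisφ μ t f)).mapL Hφ.subtypeL
  rw [freeFlow]
  refine Eq.trans (tsum_congr fun k => ?_) h.tsum_eq
  rw [map_smul, repr_flow, phaseFlow_apply, repr_basisφ, Submodule.subtypeL_apply, coe_basisφ,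
    phase]

/-- The restriction of `B` to `ℋ(φ)`. -/
def Bφ : Hφ →L[ℂ] Hφ :=
  (Bclm.comp Hφ.subtypeL).codRestrict Hφ fun f => Bclm_mem_Hφ f.2

theorem coe_Bφ (f : Hφ) : (Bφ f : L2p) = B f := rfl

theorem inner_Bφ_left (f g : Hφ) : inner ℂ (Bφ f) g = inner ℂ f (Bφ g) := by
  rw [Submodule.coe_inner, Submodule.coe_inner, coe_Bφ, coe_Bφ, inner_B_left]

/-- Only the almost everywhere class of the control matters. -/
theorem isMild_congr {u v : ℝ → ℝ} {a T : ℝ} (h : ∀ᵐ s, s ∈ Icc a T → u s = v s) {f : L2p}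
    {ψ : ℝ → L2p} (hu : IsMild u a T f ψ) : IsMild v a T f ψ := by
  intro t ht
  obtain ⟨h1, h2⟩ := hu t ht
  have h3 : ∀ᵐ s, s ∈ uIoc a t →
      (u s : ℂ) • freeFlow (t - s) (B (ψ s)) = (v s : ℂ) • freeFlow (t - s) (B (ψ s)) := by
    filter_upwards [h] with s hs hmem
    rw [uIoc_of_le ht.1] at hmem
    rw [hs ⟨hmem.1.le, hmem.2.trans ht.2⟩]
  refine ⟨h1.congr_ae ((ae_restrict_iff' measurableSet_uIoc).2 h3), ?_⟩
  rw [h2, intervalIntegral.integral_congr_ae h3]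

/-- For curves in `ℋ(φ)`, mild solutions are the solutions in the interaction picture. -/
theorem isMild_iff_isSol {u : ℝ → ℝ} (hu : Integrable u) {a T : ℝ} (haT : a ≤ T) {ψ : ℝ → Hφ}
    (hψ : ContinuousOn ψ (Icc a T)) (f : Hφ) :
    IsMild u a T f (fun t => (ψ t : L2p)) ↔
      IsSol (interaction basisφ μ Bφ u) a T a (flow basisφ μ (-a) f)
        (fun t => flow basisφ μ (-t) (ψ t)) := by
  have key : ∀ t ∈ Icc a T,
      (IntervalIntegrable (fun s => (u s : ℂ) • freeFlow (t - s) (B (ψ s))) volume a t ∧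
        (ψ t : L2p) = freeFlow (t - a) f
          - Complex.I • ∫ s in a..t, (u s : ℂ) • freeFlow (t - s) (B (ψ s))) ↔
      flow basisφ μ (-t) (ψ t) = flow basisφ μ (-a) f
        + ∫ s in a..t, interaction basisφ μ Bφ u s (flow basisφ μ (-s) (ψ s)) := by
    intro t ht
    obtain ⟨h1, h2⟩ := duhamel_iff basisφ μ Bφ hu haT hψ f ht
    refine Iff.trans ?_ h2
    have e : (fun s => (u s : ℂ) • freeFlow (t - s) (B (ψ s)))
        = fun s => Hφ.subtypeL ((u s : ℂ) • flow basisφ μ (t - s) (Bφ (ψ s))) := by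
      ext1 s
      rw [map_smul, Submodule.subtypeL_apply, ← freeFlow_coe, coe_Bφ]
    rw [e, ContinuousLinearMap.intervalIntegral_comp_comm _ h1, freeFlow_coe]
    have h3 : IntervalIntegrable
        (fun s => Hφ.subtypeL ((u s : ℂ) • flow basisφ μ (t - s) (Bφ (ψ s)))) volume a t :=
      ⟨Hφ.subtypeL.integrable_comp h1.1, Hφ.subtypeL.integrable_comp h1.2⟩
    refine ⟨fun h => Subtype.ext h.2, fun h => ⟨h3, ?_⟩⟩
    exact congrArg Subtype.val h
  constructor
  · intro h
    exact ⟨continuousOn_isometry_apply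
      (fun f => ((continuous_flow basisφ μ f).comp continuous_neg).continuousOn) hψ,
      fun t ht => (key t ht).1 (h t ht)⟩
  · intro h t ht
    exact (key t ht).2 (h.eq t ht)

/-- A mild solution with values in `ℋ(φ)` is determined by its datum. -/
theorem isMild_unique {u : ℝ → ℝ} (hu : Integrable u) {a T : ℝ} (haT : a ≤ T) {f : L2p}
    (hf : f ∈ Hφ) {ψ χ : ℝ → L2p} (hψ : ContinuousInHφ (Icc a T) ψ)
    (hχ : ContinuousInHφ (Icc a T) χ) (hψm : IsMild u a T f ψ) (hχm : IsMild u a T f χ) :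
    EqOn ψ χ (Icc a T) := by
  have key : ∀ {ψ : ℝ → L2p}, ContinuousInHφ (Icc a T) ψ → IsMild u a T f ψ →
      ∃ ψ' : ℝ → Hφ, (∀ t ∈ Icc a T, (ψ' t : L2p) = ψ t) ∧
        IsSol (interaction basisφ μ Bφ u) a T a (flow basisφ μ (-a) ⟨f, hf⟩)
          (fun t => flow basisφ μ (-t) (ψ' t)) := by
    intro ψ hψ hψm
    have he : ∀ t ∈ Icc a T, (Hφ.orthogonalProjectionOnto (ψ t) : L2p) = ψ t := fun t ht =>
      Submodule.starProjection_eq_self_iff.2 (hψ.1 t ht)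
    -- `ψ` is arbitrary outside `[a, T]`: it is projected onto `ℋ(φ)`
    refine ⟨fun t => Hφ.orthogonalProjectionOnto (ψ t), he, ?_⟩
    refine (isMild_iff_isSol hu haT (ψ := fun t => Hφ.orthogonalProjectionOnto (ψ t))
      (Hφ.orthogonalProjectionOnto.continuous.comp_continuousOn hψ.2) ⟨f, hf⟩).1 ?_
    intro t ht
    have h1 := hψm t ht
    have h2 : ∀ s ∈ uIcc a t, (u s : ℂ) • freeFlow (t - s) (B (ψ s))
        = (u s : ℂ) • freeFlow (t - s) (B (Hφ.orthogonalProjectionOnto (ψ s) : L2p)) := by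
      intro s hs
      rw [uIcc_of_le ht.1] at hs
      rw [he s ⟨hs.1, hs.2.trans ht.2⟩]
    refine ⟨h1.1.congr fun s hs => h2 s (uIoc_subset_uIcc hs), ?_⟩
    exact (he t ht).trans (h1.2.trans (by rw [intervalIntegral.integral_congr h2]))
  obtain ⟨ψ', h1, h2⟩ := key hψ hψm
  obtain ⟨χ', h3, h4⟩ := key hχ hχm
  intro t ht
  have h5 := (isIntegrableFamily_interaction basisφ μ Bφ hu).isSol_unique haT ⟨le_rfl, haT⟩ h2 h4 ht
  rw [← h1 t ht, ← h3 t ht, (flow basisφ μ (-t)).injective h5]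

theorem exists_propagator {u : ℝ → ℝ} (hu : Integrable u) {T : ℝ} (hT : 0 ≤ T) :
    ∃ Γ : ℝ → ℝ → (Hφ ≃ₗᵢ[ℂ] Hφ), IsUnitaryPropagator T Γ ∧
      ∀ s ∈ Icc 0 T, ∀ f : Hφ, IsMild u s T f (fun t => (Γ t s f : L2p)) := by
  obtain ⟨Y, hsol, hrefl, hcomp, hcont⟩ :=
    (isIntegrableFamily_interaction basisφ μ Bφ hu).exists_unitary_propagator hT
      (re_inner_interaction basisφ μ inner_Bφ_left u)
  let Γ : ℝ → ℝ → (Hφ ≃ₗᵢ[ℂ] Hφ) := fun t s =>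
    ((flow basisφ μ (-s)).trans (Y t s)).trans (flow basisφ μ t)
  have hΓ : ∀ t s f, Γ t s f = flow basisφ μ t (Y t s (flow basisφ μ (-s) f)) :=
    fun _ _ _ => rfl
  have hΓcont : ∀ f : Hφ, ContinuousOn (fun p : ℝ × ℝ => Γ p.1 p.2 f) (Icc 0 T ×ˢ Icc 0 T) := by
    intro f
    simp only [hΓ]
    refine continuousOn_isometry_apply
      (fun g => ((continuous_flow basisφ μ g).comp continuous_fst).continuousOn) ?_
    refine continuousOn_isometry_apply hcont ?_
    exact ((continuous_flow basisφ μ f).comp (continuous_neg.comp continuous_snd)).continuousOn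
  refine ⟨Γ, ⟨fun t ht f => ?_, fun t ht r hr s hs f => ?_, hΓcont⟩, fun s hs f => ?_⟩
  · rw [hΓ, hrefl t ht, flow_flow_neg]
  · rw [hΓ, hΓ, hΓ, flow_neg_flow, hcomp t ht r hr s hs]
  · have hsub : Icc s T ⊆ Icc 0 T := Icc_subset_Icc_left hs.1
    have hc : ContinuousOn (fun t => Γ t s f) (Icc s T) :=
      (hΓcont f).comp (f := fun t => (t, s)) (by fun_prop) fun t ht => ⟨hsub ht, hs⟩
    rw [isMild_iff_isSol hu hs.2 hc]
    have h1 := hsol s hs (flow basisφ μ (-s) f)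
    have h2 : (fun t => flow basisφ μ (-t) (Γ t s f)) = fun t => Y t s (flow basisφ μ (-s) f) := by
      ext1 t
      rw [hΓ, flow_neg_flow]
    rw [h2]
    exact ⟨h1.continuousOn.mono hsub, fun t ht => h1.eq t (hsub ht)⟩

/-! ### Bessel's inequality for the time frequencies -/

/-- The frequencies `μ_k = 2π (2π (k-1)²)` are integer multiples of `2π / L` when `L = N / (2π)`, so
that the `e^{iμ_k s}` are orthogonal on `[0, L]`: Bessel's inequality on any subinterval of
`[0, T]`. -/
theorem exists_bessel (T : ℝ) : ∃ C : ℝ, 0 ≤ C ∧ ∀ h : ℝ → ℂ, MemLp h 2 volume →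
    ∀ a ∈ Icc 0 T, ∀ b ∈ Icc 0 T, a ≤ b →
      (Summable fun k : ℕ+ => ‖∫ s in a..b, phase (μ k) (-s) * h s‖ ^ 2) ∧
      ∑' k : ℕ+, ‖∫ s in a..b, phase (μ k) (-s) * h s‖ ^ 2 ≤ C * ∫ s in a..b, ‖h s‖ ^ 2 := by
  have hpi := Real.pi_pos
  obtain ⟨N, hN⟩ := exists_nat_gt (max 0 (2 * Real.pi * T))
  have hN0 : (0 : ℝ) < N := (le_max_left _ _).trans_lt hN
  have hNT : 2 * Real.pi * T < N := (le_max_right _ _).trans_lt hN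
  set L : ℝ := N / (2 * Real.pi) with hL
  have hL0 : 0 < L := by positivity
  have hTL : T ≤ L := by
    rw [hL, le_div_iff₀ (by positivity)]; linarith
  -- the Fourier coefficients on `[0, L]` of `h` extended by zero outside `(a, b]`
  refine ⟨L, hL0.le, fun h hh a ha b hb hab => ?_⟩
  set g : ℝ → ℂ := (Ioc a b).indicator h with hg
  have hsub : Ioc a b ⊆ Ioc 0 L := Ioc_subset_Ioc ha.1 (hb.2.trans hTL)
  have hgL2 : MemLp g 2 (volume.restrict (Ioc 0 L)) :=
    (hh.indicator measurableSet_Ioc).restrict _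
  let n : ℕ+ → ℤ := fun k => -(N * ((k : ℤ) - 1) ^ 2)
  have hn : Function.Injective n := by
    intro j k hjk
    have hN' : (N : ℤ) ≠ 0 := by
      have : N ≠ 0 := by rintro rfl; simp at hN0
      exact_mod_cast this
    have h1 : ((j : ℤ) - 1) ^ 2 = ((k : ℤ) - 1) ^ 2 := by
      have := neg_injective hjk
      exact mul_left_cancel₀ hN' this
    have hj := j.pos
    have hk := k.pos
    rw [sq_eq_sq₀ (by omega) (by omega)] at h1
    exact PNat.coe_injective (by omega)
  have hcoef : ∀ k : ℕ+, ∫ s in a..b, phase (μ k) (-s) * h s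
      = (L : ℂ) * fourierCoeffOn hL0 g (n k) := by
    intro k
    have hLc : (L : ℂ) ≠ 0 := by exact_mod_cast hL0.ne'
    rw [fourierCoeffOn_eq_integral, sub_zero, ← Complex.coe_smul, smul_eq_mul, ← mul_assoc]
    push_cast
    rw [mul_one_div_cancel hLc, one_mul, intervalIntegral.integral_of_le hab,
      intervalIntegral.integral_of_le hL0.le]
    have e : (fun x : ℝ => fourier (-n k) (x : AddCircle L) • g x)
        = (Ioc a b).indicator (fun s => phase (μ k) (-s) * h s) := by
      ext x
      by_cases hx : x ∈ Ioc a b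
      · rw [hg, indicator_of_mem hx, indicator_of_mem hx, fourier_coe_apply, smul_eq_mul, phase]
        congr 2
        simp only [n, μ, hL]
        have : (Real.pi : ℂ) ≠ 0 := by exact_mod_cast hpi.ne'
        have : (N : ℂ) ≠ 0 := by exact_mod_cast hN0.ne'
        push_cast
        field_simp
        ring
      · rw [hg, indicator_of_notMem hx, indicator_of_notMem hx, smul_zero]
    rw [e, setIntegral_indicator measurableSet_Ioc, inter_eq_self_of_subset_right hsub]
  have hsum := hasSum_sq_fourierCoeffOn hL0 hgL2
  have hnorm : ∫ s in (0 : ℝ)..L, ‖g s‖ ^ 2 = ∫ s in a..b, ‖h s‖ ^ 2 := by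
    rw [intervalIntegral.integral_of_le hab, intervalIntegral.integral_of_le hL0.le]
    have e : (fun x : ℝ => ‖g x‖ ^ 2) = (Ioc a b).indicator (fun s => ‖h s‖ ^ 2) := by
      ext x
      by_cases hx : x ∈ Ioc a b
      · rw [hg, indicator_of_mem hx, indicator_of_mem hx]
      · rw [hg, indicator_of_notMem hx, indicator_of_notMem hx]; simp
    rw [e, setIntegral_indicator measurableSet_Ioc, inter_eq_self_of_subset_right hsub]
  have hterm : (fun k : ℕ+ => ‖∫ s in a..b, phase (μ k) (-s) * h s‖ ^ 2)
      = fun k => L ^ 2 * ‖fourierCoeffOn hL0 g (n k)‖ ^ 2 := by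
    ext k
    rw [hcoef, norm_mul, mul_pow, Complex.norm_real, Real.norm_of_nonneg hL0.le]
  have hs : Summable fun k : ℕ+ => ‖fourierCoeffOn hL0 g (n k)‖ ^ 2 :=
    hsum.summable.comp_injective hn
  rw [hterm]
  refine ⟨hs.mul_left _, ?_⟩
  rw [tsum_mul_left]
  have h1 : ∑' k : ℕ+, ‖fourierCoeffOn hL0 g (n k)‖ ^ 2 ≤ ∑' i : ℤ, ‖fourierCoeffOn hL0 g i‖ ^ 2 :=
    tsum_comp_le_tsum_of_inj hsum.summable (fun _ => by positivity) hn
  rw [hsum.tsum_eq, hnorm, sub_zero] at h1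
  calc L ^ 2 * ∑' k : ℕ+, ‖fourierCoeffOn hL0 g (n k)‖ ^ 2
      ≤ L ^ 2 * (L⁻¹ * ∫ s in a..b, ‖h s‖ ^ 2) := by gcongr; simpa using h1
    _ = L * ∫ s in a..b, ‖h s‖ ^ 2 := by field_simp

/-! ### Convolutions and coordinatewise operators -/

/-- Young's inequality `ℓ¹ * ℓ² ⊆ ℓ²` on `ℤ`, for a correlation: it is the absolutely convergent
sum of the translates of `κ` in the Banach space `ℓ²`. -/
theorem summable_correlation {β κ : ℤ → ℝ} (hβ : Summable fun n => |β n|)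
    (hκ : Summable fun n => κ n ^ 2) :
    (∀ m, Summable fun n => β n * κ (m + n)) ∧ Summable fun m => (∑' n, β n * κ (m + n)) ^ 2 := by
  have hmem : ∀ n : ℤ, Memℓp (fun m => κ (m + n)) 2 := fun n => by
    refine memℓp_gen ?_
    simp only [ENNReal.toReal_ofNat, Real.norm_eq_abs, Real.rpow_ofNat, sq_abs]
    exact hκ.comp_injective (add_left_injective n)
  let τ : ℤ → ℓ²(ℤ, ℝ) := fun n => ⟨fun m => κ (m + n), hmem n⟩
  have hτ : ∀ n, ‖τ n‖ = ‖τ 0‖ := fun n => by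
    rw [lp.norm_eq_tsum_rpow (by norm_num), lp.norm_eq_tsum_rpow (by norm_num)]
    congr 1
    refine Eq.trans ?_ ((Equiv.addRight n).tsum_eq _)
    refine tsum_congr fun m => ?_
    change ‖κ (m + n)‖ ^ _ = ‖κ (m + n + 0)‖ ^ _
    rw [add_zero]
  have hs : Summable fun n => β n • τ n := by
    refine Summable.of_norm ?_
    simp only [norm_smul, hτ, Real.norm_eq_abs]
    exact hβ.mul_right _
  obtain ⟨S, hS⟩ := hs
  have hc : ∀ m, HasSum (fun n => β n * κ (m + n)) (S m) := fun m => by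
    have h := hS.mapL (lp.evalCLM ℝ (fun _ : ℤ => ℝ) 2 m)
    exact h
  refine ⟨fun m => (hc m).summable, ?_⟩
  have h := (lp.memℓp S).summable (p := 2) (by norm_num)
  simp only [ENNReal.toReal_ofNat, Real.norm_eq_abs, Real.rpow_ofNat, sq_abs] at h
  exact h.congr fun m => by rw [(hc m).tsum_eq]

/-- A sequence of functionals that takes its values in `ℓ²` is a bounded operator, by the closed
graph theorem. -/
theorem exists_clm_of_memℓp {ι E : Type*} [NormedAddCommGroup E] [NormedSpace ℂ E] [CompleteSpace E]
    (F : ι → E →L[ℂ] ℂ) (hF : ∀ a, Memℓp (fun i => F i a) 2) :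
    ∃ R : E →L[ℂ] ℓ²(ι, ℂ), ∀ a i, R a i = F i a := by
  let R₀ : E →ₗ[ℂ] ℓ²(ι, ℂ) :=
    { toFun := fun a => ⟨fun i => F i a, hF a⟩
      map_add' := fun a b => by ext i; exact map_add (F i) a b
      map_smul' := fun c a => by ext i; exact map_smul (F i) c a }
  refine ⟨⟨R₀, R₀.continuous_of_seq_closed_graph fun x a y hx hy => ?_⟩, fun a i => rfl⟩
  ext i
  have h1 : Tendsto (fun j => F i (x j)) atTop (𝓝 (F i a)) := ((F i).continuous.tendsto a).comp hx
  have h2 : Tendsto (fun j => F i (x j)) atTop (𝓝 (y i)) :=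
    ((lp.evalCLM ℂ (fun _ : ι => ℂ) 2 i).continuous.tendsto y).comp hy
  exact tendsto_nhds_unique h2 h1

/-! ### The control operator in `H⁴(φ)` -/

theorem exists_weightOp : ∃ R : ℓ²(ℕ+, ℂ) →L[ℂ] ℓ²(ℕ+, ℂ),
    ∀ a (k : ℕ+), R a k = ((k : ℂ) ^ 4)⁻¹ * a k := by
  refine exists_clm_of_memℓp
    (fun k : ℕ+ => ((k : ℂ) ^ 4)⁻¹ • lp.evalCLM ℂ (fun _ : ℕ+ => ℂ) 2 k) fun a => ?_
  refine memℓp_of_summable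
    ((summable_norm_sq a).of_nonneg_of_le (fun _ => by positivity) fun k => ?_)
  gcongr
  change ‖((k : ℂ) ^ 4)⁻¹ * a k‖ ≤ ‖a k‖
  rw [norm_mul, norm_inv, norm_pow, Complex.norm_natCast]
  refine mul_le_of_le_one_left (norm_nonneg _) (inv_le_one_of_one_le₀ (one_le_pow₀ ?_))
  exact_mod_cast k.pos

/-- The bounded operator `(a_k) ↦ (k⁻⁴ a_k)` of `ℓ²`. -/
def weightOp : ℓ²(ℕ+, ℂ) →L[ℂ] ℓ²(ℕ+, ℂ) := exists_weightOp.choose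

theorem weightOp_apply (a : ℓ²(ℕ+, ℂ)) (k : ℕ+) : weightOp a k = ((k : ℂ) ^ 4)⁻¹ * a k :=
  exists_weightOp.choose_spec a k

/-- The element of `H⁴(φ)` with `k⁴ ⟪φ_k, ·⟫ = a_k`. -/
def ofWeighted : ℓ²(ℕ+, ℂ) →L[ℂ] Hφ :=
  basisφ.repr.symm.toContinuousLinearEquiv.toContinuousLinearMap.comp weightOp

theorem repr_ofWeighted (a : ℓ²(ℕ+, ℂ)) (k : ℕ+) :
    basisφ.repr (ofWeighted a) k = ((k : ℂ) ^ 4)⁻¹ * a k := by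
  rw [← weightOp_apply]
  exact congrArg (fun c : ℓ²(ℕ+, ℂ) => c k) (basisφ.repr.apply_symm_apply (weightOp a))

theorem inner_φ_ofWeighted (a : ℓ²(ℕ+, ℂ)) (k : ℕ+) :
    inner ℂ (φ k) (ofWeighted a : L2p) = ((k : ℂ) ^ 4)⁻¹ * a k := by
  rw [← repr_basisφ, repr_ofWeighted]

/-- The index of the eigenfunction with frequencies `±n`. -/
def idx (n : ℤ) : ℕ+ := n.natAbs.succPNat

theorem coe_idx (n : ℤ) : ((idx n : ℕ) : ℝ) = |(n : ℝ)| + 1 := by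
  simp [idx, Nat.cast_natAbs]

theorem summable_idx {F : ℕ+ → ℝ} (hF : Summable F) : Summable fun n => F (idx n) := by
  refine Summable.of_nat_of_neg ?_ ?_
  · refine (hF.comp_injective Nat.succPNat_injective).congr fun n => ?_
    simp [idx]
  · refine (hF.comp_injective Nat.succPNat_injective).congr fun n => ?_
    simp [idx]

theorem summable_inv_idx_pow {p : ℕ} (hp : 1 < p) :
    Summable fun n => (((idx n : ℕ) : ℝ) ^ p)⁻¹ := by
  refine summable_idx (F := fun k : ℕ+ => (((k : ℕ) : ℝ) ^ p)⁻¹) ?_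
  exact (Real.summable_nat_pow_inv.2 hp).comp_injective PNat.coe_injective

theorem norm_inner_expo_ofWeighted_le (a : ℓ²(ℕ+, ℂ)) (n : ℤ) :
    ‖inner ℂ (expo n) (ofWeighted a : L2p)‖ ≤ 2 * ((((idx n : ℕ) : ℝ) ^ 4)⁻¹ * ‖a (idx n)‖) := by
  have hf := (ofWeighted a).2
  have h0 : 0 ≤ (((idx n : ℕ) : ℝ) ^ 4)⁻¹ * ‖a (idx n)‖ := by positivity
  have hk : ‖inner ℂ (φ (idx n)) (ofWeighted a : L2p)‖
      = (((idx n : ℕ) : ℝ) ^ 4)⁻¹ * ‖a (idx n)‖ := by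
    rw [inner_φ_ofWeighted, norm_mul, norm_inv, norm_pow, Complex.norm_natCast]
  by_cases hn : n = 0
  · subst hn
    have h1 : idx 0 = 1 := rfl
    rw [h1, inner_φ_one, norm_mul, Complex.norm_real, Real.norm_of_nonneg (by positivity)] at hk
    rw [h1] at h0 ⊢
    rw [← hk]
    have h2 : (1 : ℝ) ≤ Real.sqrt 2 := Real.one_le_sqrt.2 (by norm_num)
    have h3 := norm_nonneg (inner ℂ (expo 0) (ofWeighted a : L2p))
    nlinarith
  · have h1 : idx n ≠ 1 := by
      intro h
      have := congrArg PNat.val h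
      simp [idx] at this
      exact hn this
    have h2 : ((idx n : ℕ) : ℤ) - 1 = |n| := by simp [idx]
    rw [inner_φ_of_ne_one hf h1, h2] at hk
    have h3 : inner ℂ (expo |n|) (ofWeighted a : L2p) = inner ℂ (expo n) (ofWeighted a : L2p) := by
      rcases abs_choice n with h | h <;> rw [h]
      exact inner_expo_neg hf n
    rw [h3] at hk
    rw [hk]
    linarith

theorem summable_inner_expo_ofWeighted (a : ℓ²(ℕ+, ℂ)) :
    Summable fun n => ‖inner ℂ (expo n) (ofWeighted a : L2p)‖ := by
  refine Summable.of_nonneg_of_le (fun _ => norm_nonneg _) (fun n => ?_)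
    ((summable_inv_idx_pow (p := 4) (by norm_num)).mul_left (2 * ‖a‖))
  refine (norm_inner_expo_ofWeighted_le a n).trans ?_
  have h1 : ‖a (idx n)‖ ≤ ‖a‖ := lp.norm_apply_le_norm (by norm_num) a _
  calc _ ≤ 2 * ((((idx n : ℕ) : ℝ) ^ 4)⁻¹ * ‖a‖) := by gcongr
    _ = _ := by ring

/-- Twice the value at the vertex: the sum of the `⟪e_n, ψ⟫`, each of which is twice the `n`-th
Fourier coefficient, both edges contributing equally. -/
def vertexValue : ℓ²(ℕ+, ℂ) →L[ℂ] ℂ :=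
  LinearMap.mkContinuous
    { toFun := fun a => ∑' n, inner ℂ (expo n) (ofWeighted a : L2p)
      map_add' := fun a b => by
        rw [← (summable_inner_expo_ofWeighted a).of_norm.tsum_add
          (summable_inner_expo_ofWeighted b).of_norm]
        refine tsum_congr fun n => ?_
        rw [map_add, Submodule.coe_add, inner_add_right]
      map_smul' := fun c a => by
        rw [RingHom.id_apply, smul_eq_mul, ← tsum_mul_left]
        refine tsum_congr fun n => ?_
        rw [map_smul, Submodule.coe_smul, inner_smul_right] }
    (2 * ∑' n, (((idx n : ℕ) : ℝ) ^ 4)⁻¹) fun a => by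
      refine tsum_of_norm_bounded (f := fun n => inner ℂ (expo n) (ofWeighted a : L2p))
        (g := fun n => 2 * ((((idx n : ℕ) : ℝ) ^ 4)⁻¹ * ‖a‖)) ?_ fun n => ?_
      · rw [mul_assoc]
        exact ((summable_inv_idx_pow (p := 4) (by norm_num)).hasSum.mul_right ‖a‖).mul_left 2
      · refine (norm_inner_expo_ofWeighted_le a n).trans ?_
        have h1 : ‖a (idx n)‖ ≤ ‖a‖ := lp.norm_apply_le_norm (by norm_num) a _
        gcongr

theorem hasSum_vertexValue (a : ℓ²(ℕ+, ℂ)) :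
    HasSum (fun n => inner ℂ (expo n) (ofWeighted a : L2p)) (vertexValue a) :=
  (summable_inner_expo_ofWeighted a).of_norm.hasSum

/-- The weighted Fourier coefficient `k⁴ V̂(k-1)` of the potential, for `k ≥ 2`: it comes from the
jump of the third derivative at the vertex. For `k = 1` the value is `0`, as `0⁻¹ = 0`. -/
def jumpCoeff (k : ℕ+) : ℂ :=
  -(3 / (2 * Real.pi ^ 4)) * ((k : ℂ) ^ 4 * (((k : ℂ) - 1) ^ 4)⁻¹)

theorem norm_bernoulli_const_le : ‖(3 / (2 * Real.pi ^ 4) : ℂ)‖ ≤ 1 := by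
  have h : (3 / (2 * Real.pi ^ 4) : ℂ) = ((3 / (2 * Real.pi ^ 4) : ℝ) : ℂ) := by push_cast; rfl
  rw [h, Complex.norm_real, Real.norm_of_nonneg (by positivity), div_le_one (by positivity)]
  have h3 := Real.pi_gt_three
  have : (3 : ℝ) ^ 4 ≤ Real.pi ^ 4 := by gcongr
  linarith

theorem norm_jumpCoeff_le (k : ℕ+) : ‖jumpCoeff k‖ ≤ 16 := by
  by_cases hk : k = 1
  · subst hk; simp [jumpCoeff]
  · have h2 : (2 : ℝ) ≤ k := by
      have : 2 ≤ (k : ℕ) := by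
        have := k.pos
        have h1 : (k : ℕ) ≠ 1 := fun h => hk (PNat.coe_eq_one_iff.1 h)
        omega
      exact_mod_cast this
    have e : ((k : ℂ) ^ 4 * (((k : ℂ) - 1) ^ 4)⁻¹) = ((((k : ℝ) / ((k : ℝ) - 1)) ^ 4 : ℝ) : ℂ) := by
      push_cast; rw [div_pow, div_eq_mul_inv]
    have h3 : (k : ℝ) / ((k : ℝ) - 1) ≤ 2 := by
      rw [div_le_iff₀ (by linarith)]; linarith
    have h4 : 0 ≤ (k : ℝ) / ((k : ℝ) - 1) := div_nonneg (by linarith) (by linarith)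
    rw [jumpCoeff, norm_mul, norm_neg, e, Complex.norm_real, Real.norm_of_nonneg (by positivity)]
    calc _ ≤ 1 * (2 : ℝ) ^ 4 := by
          gcongr
          exact norm_bernoulli_const_le
      _ = 16 := by norm_num

/-- `|m⁴ - r⁴| ≤ 15 (|n| |r|³ + n⁴)` for `n = m + r`. -/
theorem abs_pow_four_sub_le (m r : ℝ) :
    |m ^ 4 - r ^ 4| ≤ 15 * (|m + r| * |r| ^ 3 + (m + r) ^ 4) := by
  set n := m + r with hn
  have hm : m = n - r := by rw [hn]; ring
  have e : m ^ 4 - r ^ 4 = n * (n ^ 3 - 4 * n ^ 2 * r + 6 * n * r ^ 2 - 4 * r ^ 3) := by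
    rw [hm]; ring
  have hn0 := abs_nonneg n
  have hr0 := abs_nonneg r
  have h1 : |n ^ 3 - 4 * n ^ 2 * r + 6 * n * r ^ 2 - 4 * r ^ 3|
      ≤ |n| ^ 3 + 4 * |n| ^ 2 * |r| + 6 * |n| * |r| ^ 2 + 4 * |r| ^ 3 := by
    refine (abs_sub _ _).trans (add_le_add ((abs_add_le _ _).trans (add_le_add
      ((abs_sub _ _).trans (add_le_add ?_ ?_)) ?_)) ?_) <;>
      simp [abs_mul, abs_pow]
  have h2 : n ^ 4 = |n| * |n| ^ 3 := by
    rw [← pow_succ', show |n| ^ (3 + 1) = n ^ 4 from Even.pow_abs (by decide) n]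
  rw [e, abs_mul, h2]
  suffices h3 : |n ^ 3 - 4 * n ^ 2 * r + 6 * n * r ^ 2 - 4 * r ^ 3| ≤ 15 * (|r| ^ 3 + |n| ^ 3) by
    calc _ ≤ |n| * (15 * (|r| ^ 3 + |n| ^ 3)) := by gcongr
      _ = _ := by ring
  refine h1.trans ?_
  rcases le_total |n| |r| with h | h
  · have a1 : |n| ^ 2 * |r| ≤ |r| ^ 2 * |r| := by gcongr
    have a2 : |n| * |r| ^ 2 ≤ |r| * |r| ^ 2 := by gcongr
    nlinarith [pow_nonneg hn0 3, pow_nonneg hr0 3]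
  · have a1 : |n| ^ 2 * |r| ≤ |n| ^ 2 * |n| := by gcongr
    have a2 : |n| * |r| ^ 2 ≤ |n| * |n| ^ 2 := by gcongr
    have a3 : |r| ^ 3 ≤ |n| ^ 3 := by gcongr
    nlinarith [pow_nonneg hn0 3, pow_nonneg hr0 3]

/-- In `H⁴(φ)` the control operator is a bounded operator up to a singular part of rank one: the
jump of the third derivative of the potential at the vertex contributes a multiple of the value at
the vertex, with Fourier coefficients of size comparable to `k⁻⁴`. -/
theorem exists_regularPart : ∃ R : ℓ²(ℕ+, ℂ) →L[ℂ] ℓ²(ℕ+, ℂ), ∀ a (k : ℕ+),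
    (k : ℂ) ^ 4 * inner ℂ (φ k) (B (ofWeighted a)) = jumpCoeff k * vertexValue a + R a k := by
  let F : ℕ+ → ℓ²(ℕ+, ℂ) →L[ℂ] ℂ := fun k =>
    (k : ℂ) ^ 4 • (innerSL ℂ (φ k)).comp (Bclm.comp (Hφ.subtypeL.comp ofWeighted))
      - jumpCoeff k • vertexValue
  have hF : ∀ k a, F k a = (k : ℂ) ^ 4 * inner ℂ (φ k) (B (ofWeighted a))
      - jumpCoeff k * vertexValue a := fun k a => rfl
  suffices h : ∀ a, Memℓp (fun k => F k a) 2 by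
    obtain ⟨R, hR⟩ := exists_clm_of_memℓp F h
    exact ⟨R, fun a k => by rw [hR, hF]; ring⟩
  intro a
  set w : ℤ → ℂ := fun n => inner ℂ (expo n) (ofWeighted a : L2p) with hw
  set α : ℤ → ℝ := fun n => ‖a (idx n)‖ with hα
  have hα0 : ∀ n, 0 ≤ α n := fun n => norm_nonneg _
  have hαs : Summable fun n => α n ^ 2 :=
    summable_idx (F := fun k => ‖a k‖ ^ 2) (summable_norm_sq a)
  have hw4 : ∀ n, ((idx n : ℕ) : ℝ) ^ 4 * ‖w n‖ ≤ 2 * α n := fun n => by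
    have h := norm_inner_expo_ofWeighted_le a n
    have h1 : (0 : ℝ) < ((idx n : ℕ) : ℝ) ^ 4 := by
      have : (0 : ℝ) < (idx n : ℕ) := by exact_mod_cast (idx n).pos
      positivity
    calc _ ≤ ((idx n : ℕ) : ℝ) ^ 4 * (2 * ((((idx n : ℕ) : ℝ) ^ 4)⁻¹ * ‖a (idx n)‖)) := by gcongr
      _ = _ := by field_simp; rfl
  set β : ℤ → ℝ := fun n => |(n : ℝ)| * ‖w n‖ with hβ
  have hβ0 : ∀ n, 0 ≤ β n := fun n => by positivity
  have hβs : Summable β := by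
    refine Summable.of_nonneg_of_le hβ0 (fun n => ?_)
      ((summable_inv_idx_pow (p := 3) (by norm_num)).mul_left (2 * ‖a‖))
    have h1 : α n ≤ ‖a‖ := lp.norm_apply_le_norm (by norm_num) a _
    have h2 : (0 : ℝ) < (idx n : ℕ) := by exact_mod_cast (idx n).pos
    have h3 : |(n : ℝ)| ≤ (idx n : ℕ) := by rw [coe_idx]; linarith
    have h4 := hw4 n
    rw [← div_eq_mul_inv, le_div_iff₀ (by positivity)]
    calc β n * ((idx n : ℕ) : ℝ) ^ 3 ≤ ((idx n : ℕ) * ‖w n‖) * ((idx n : ℕ) : ℝ) ^ 3 := by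
          simp only [hβ]; gcongr
      _ = ((idx n : ℕ) : ℝ) ^ 4 * ‖w n‖ := by ring
      _ ≤ 2 * ‖a‖ := by linarith
  set κ : ℤ → ℝ := fun r => |(r : ℝ)|⁻¹ with hκ
  have hκs : Summable fun r => κ r ^ 2 := by
    refine (Real.summable_one_div_int_pow.2 (show 1 < 2 by norm_num)).congr fun n => ?_
    simp only [hκ, inv_pow, sq_abs, one_div]
  have hκ4s : Summable fun r => κ r ^ 4 := by
    refine (Real.summable_one_div_int_pow.2 (show 1 < 4 by norm_num)).congr fun n => ?_
    simp only [hκ, inv_pow, one_div]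
    rw [Even.pow_abs (by decide)]
  -- the two correlations that dominate the regular part
  obtain ⟨hG1, hG1s⟩ := summable_correlation (β := fun n => β (-n)) (κ := κ)
    ((((Equiv.neg ℤ).summable_iff (f := β)).2 hβs).congr fun n => (abs_of_nonneg (hβ0 _)).symm) hκs
  obtain ⟨hG2, hG2s⟩ := summable_correlation (β := fun n => κ n ^ 4) (κ := α)
    (by
      refine hκ4s.congr fun n => ?_
      rw [abs_of_nonneg (by positivity)]) hαs
  set G1 : ℤ → ℝ := fun m => ∑' n, β (-n) * κ (m + n) with hG1def
  set G2 : ℤ → ℝ := fun m => ∑' n, κ n ^ 4 * α (m + n) with hG2def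
  set t : ℤ → ℤ → ℝ := fun m r =>
    (if r = 0 then α m else 0) + β (m + r) * κ r + κ r ^ 4 * α (m + r) with ht
  have htsum : ∀ m, HasSum (t m) (α m + G1 m + G2 m) := fun m => by
    have h1 : HasSum (fun r => β (m + r) * κ r) (G1 m) := by
      have h := (Equiv.subLeft (-m)).hasSum_iff.2 (hG1 m).hasSum
      refine h.congr_fun fun r => ?_
      simp only [Function.comp_apply, Equiv.subLeft_apply, hκ]
      have e1 : -(-m - r) = m + r := by ring
      have e2 : m + (-m - r) = -r := by ring
      rw [e1, e2, Int.cast_neg, abs_neg]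
    exact ((hasSum_ite_eq 0 (α m)).add h1).add (hG2 m).hasSum
  have hterm : ∀ (k : ℕ+) (r : ℤ),
      ‖((k : ℂ) ^ 4 * Vhat r - jumpCoeff k) * w ((k : ℤ) - 1 + r)‖ ≤ 480 * t ((k : ℤ) - 1) r := by
    intro k r
    set m : ℤ := (k : ℤ) - 1 with hm
    have hk0 := k.pos
    have hkR : (1 : ℝ) ≤ ((k : ℕ) : ℝ) := by exact_mod_cast hk0
    have ht1 : 0 ≤ β (m + r) * κ r := mul_nonneg (hβ0 _) (by positivity)
    have ht2 : 0 ≤ κ r ^ 4 * α (m + r) := mul_nonneg (by positivity) (hα0 _)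
    rw [norm_mul]
    by_cases hr : r = 0
    · have hidx : idx m = k := PNat.coe_injective (by simp [idx, hm]; omega)
      have h1 : ‖(k : ℂ) ^ 4 * Vhat r - jumpCoeff k‖ ≤ 17 * ((k : ℕ) : ℝ) ^ 4 := by
        have h2 : Vhat r = 1 / 30 := by simp [Vhat, hr]
        have h3 : (1 : ℝ) ≤ ((k : ℕ) : ℝ) ^ 4 := one_le_pow₀ hkR
        refine (norm_sub_le _ _).trans ?_
        have h4 := norm_jumpCoeff_le k
        rw [h2, norm_mul, norm_pow, Complex.norm_natCast, norm_div, norm_one,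
          Complex.norm_ofNat]
        linarith
      have h2 := hw4 m
      rw [hidx] at h2
      have h3 : α m ≤ t m r := by
        simp only [ht, hr, if_true]
        rw [hr] at ht1 ht2
        linarith
      rw [hr, add_zero]
      rw [hr] at h1 h3
      calc _ ≤ 17 * ((k : ℕ) : ℝ) ^ 4 * ‖w m‖ := by gcongr
        _ = 17 * (((k : ℕ) : ℝ) ^ 4 * ‖w m‖) := by ring
        _ ≤ 17 * (2 * α m) := by gcongr
        _ ≤ 480 * t m 0 := by linarith [hα0 m]
    · have ht3 : t m r = β (m + r) * κ r + κ r ^ 4 * α (m + r) := by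
        simp only [ht, hr, if_false, zero_add]
      have hV : Vhat r = -(3 / (2 * Real.pi ^ 4) * (1 / (r : ℂ) ^ 4)) := by
        simp only [Vhat, hr, if_false, zero_sub]
      rw [ht3]
      by_cases hk : k = 1
      · have hj : jumpCoeff k = 0 := by simp [jumpCoeff, hk]
        have h1 : ‖(k : ℂ) ^ 4 * Vhat r - jumpCoeff k‖ ≤ κ r ^ 4 := by
          rw [hj, hV, hk, sub_zero, norm_mul, norm_neg, norm_mul]
          have e : ‖(1 / (r : ℂ) ^ 4)‖ = κ r ^ 4 := by
            simp only [hκ, one_div, norm_inv, norm_pow, Complex.norm_intCast, inv_pow]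
          rw [e]
          simp only [PNat.one_coe, Nat.cast_one, one_pow, norm_one, one_mul]
          exact mul_le_of_le_one_left (by positivity) norm_bernoulli_const_le
        have h2 : ‖w (m + r)‖ ≤ 2 * α (m + r) := by
          refine le_trans ?_ (hw4 (m + r))
          refine le_mul_of_one_le_left (norm_nonneg _) (one_le_pow₀ ?_)
          exact_mod_cast (idx (m + r)).pos
        calc _ ≤ κ r ^ 4 * (2 * α (m + r)) := by gcongr
          _ ≤ _ := by linarith
      · have hk2 : 2 ≤ (k : ℕ) := by
          have h1 : (k : ℕ) ≠ 1 := fun h => hk (PNat.coe_eq_one_iff.1 h)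
          omega
        have hmR : (m : ℝ) = ((k : ℕ) : ℝ) - 1 := by rw [hm]; push_cast; ring
        have hm0 : (m : ℝ) ≠ 0 := by
          have : m ≠ 0 := by omega
          exact_mod_cast this
        have hr0 : (r : ℝ) ≠ 0 := by exact_mod_cast hr
        -- the leading terms cancel
        have e : (k : ℂ) ^ 4 * Vhat r - jumpCoeff k
            = jumpCoeff k * ((((m : ℝ) ^ 4 - (r : ℝ) ^ 4) / (r : ℝ) ^ 4 : ℝ) : ℂ) := by
          have hm0' : ((k : ℂ) - 1) ≠ 0 := by
            have h2 : ((m : ℝ) : ℂ) ≠ 0 := by exact_mod_cast hm0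
            rw [hmR] at h2
            push_cast at h2
            exact h2
          have hr0' : (r : ℂ) ≠ 0 := by exact_mod_cast hr
          have hpi : (Real.pi : ℂ) ≠ 0 := by exact_mod_cast Real.pi_ne_zero
          rw [hV, jumpCoeff, hmR]
          push_cast
          field_simp
          ring
        have h1 : ‖(k : ℂ) ^ 4 * Vhat r - jumpCoeff k‖
            ≤ 16 * (15 * (|((m + r : ℤ) : ℝ)| * κ r + ((m + r : ℤ) : ℝ) ^ 4 * κ r ^ 4)) := by
          rw [e, norm_mul, Complex.norm_real, Real.norm_eq_abs, abs_div]
          have h2 := abs_pow_four_sub_le m r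
          have h3 : |(r : ℝ) ^ 4| = |(r : ℝ)| ^ 4 := abs_pow _ _
          have h4 : 0 < |(r : ℝ)| := abs_pos.2 hr0
          have h5 : |(m : ℝ) ^ 4 - (r : ℝ) ^ 4| / |(r : ℝ) ^ 4|
              ≤ 15 * (|((m + r : ℤ) : ℝ)| * κ r + ((m + r : ℤ) : ℝ) ^ 4 * κ r ^ 4) := by
            rw [h3, div_le_iff₀ (by positivity)]
            refine h2.trans (le_of_eq ?_)
            simp only [hκ]
            push_cast
            field_simp
          gcongr
          exact norm_jumpCoeff_le k
        have h2 : ((m + r : ℤ) : ℝ) ^ 4 * ‖w (m + r)‖ ≤ 2 * α (m + r) := by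
          refine le_trans ?_ (hw4 (m + r))
          rw [coe_idx, ← Even.pow_abs (show Even 4 by decide) ((m + r : ℤ) : ℝ)]
          gcongr
          linarith
        have h3 : κ r ^ 4 * (((m + r : ℤ) : ℝ) ^ 4 * ‖w (m + r)‖) ≤ κ r ^ 4 * (2 * α (m + r)) := by
          gcongr
        calc _ ≤ 16 * (15 * (|((m + r : ℤ) : ℝ)| * κ r + ((m + r : ℤ) : ℝ) ^ 4 * κ r ^ 4))
              * ‖w (m + r)‖ := by gcongr
          _ = 240 * (β (m + r) * κ r + κ r ^ 4 * (((m + r : ℤ) : ℝ) ^ 4 * ‖w (m + r)‖)) := by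
              simp only [hβ]; ring
          _ ≤ 240 * (β (m + r) * κ r + κ r ^ 4 * (2 * α (m + r))) := by gcongr
          _ ≤ _ := by linarith
  have hbound : ∀ k : ℕ+, ‖F k a‖
      ≤ 480 * (α ((k : ℤ) - 1) + G1 ((k : ℤ) - 1) + G2 ((k : ℤ) - 1)) := by
    intro k
    have h1 := (hasSum_inner_expo_B (ofWeighted a) ((k : ℤ) - 1)).mul_left ((k : ℂ) ^ 4)
    have h2 := ((Equiv.addLeft ((k : ℤ) - 1)).hasSum_iff.2 (hasSum_vertexValue a)).mul_left
      (jumpCoeff k)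
    have h3 : HasSum
        (fun r => ((k : ℂ) ^ 4 * Vhat r - jumpCoeff k) * w ((k : ℤ) - 1 + r))
        ((k : ℂ) ^ 4 * inner ℂ (expo ((k : ℤ) - 1)) (B (ofWeighted a))
          - jumpCoeff k * vertexValue a) := by
      refine (h1.sub h2).congr_fun fun r => ?_
      simp only [Function.comp_apply, Equiv.coe_addLeft, hw]
      ring
    have h4 : ‖(k : ℂ) ^ 4 * inner ℂ (expo ((k : ℤ) - 1)) (B (ofWeighted a))
          - jumpCoeff k * vertexValue a‖
        ≤ 480 * (α ((k : ℤ) - 1) + G1 ((k : ℤ) - 1) + G2 ((k : ℤ) - 1)) := by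
      rw [← h3.tsum_eq]
      exact tsum_of_norm_bounded ((htsum ((k : ℤ) - 1)).mul_left 480) (hterm k)
    refine le_trans ?_ h4
    rw [hF]
    by_cases hk : k = 1
    · subst hk
      have hj : jumpCoeff 1 = 0 := by simp [jumpCoeff]
      have hs : Real.sqrt 2 / 2 ≤ 1 := by
        have : Real.sqrt 2 ≤ 2 := Real.sqrt_le_iff.2 ⟨by norm_num, by norm_num⟩
        linarith
      rw [hj, inner_φ_one]
      simp only [zero_mul, sub_zero, PNat.one_coe, Nat.cast_one, one_pow, one_mul, sub_self]
      rw [norm_mul, Complex.norm_real, Real.norm_of_nonneg (by positivity)]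
      exact mul_le_of_le_one_left (norm_nonneg _) hs
    · rw [inner_φ_of_ne_one (B_mem_Hφ (ofWeighted a).2) hk]
  have hG10 : ∀ m, 0 ≤ G1 m := fun m =>
    tsum_nonneg fun n => mul_nonneg (hβ0 _) (by positivity)
  have hG20 : ∀ m, 0 ≤ G2 m := fun m =>
    tsum_nonneg fun n => mul_nonneg (by positivity) (hα0 _)
  have hsq : Summable fun m => (α m + G1 m + G2 m) ^ 2 := by
    refine Summable.of_nonneg_of_le (fun _ => by positivity) (fun m => ?_)
      (((hαs.add hG1s).add hG2s).mul_left 3)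
    nlinarith [sq_nonneg (α m - G1 m), sq_nonneg (α m - G2 m), sq_nonneg (G1 m - G2 m)]
  have hinj : Function.Injective fun k : ℕ+ => (k : ℤ) - 1 := fun j k h =>
    PNat.coe_injective (by simpa using h)
  refine memℓp_of_summable (Summable.of_nonneg_of_le (fun _ => by positivity) (fun k => ?_)
    ((hsq.comp_injective hinj).mul_left (480 ^ 2)))
  calc ‖F k a‖ ^ 2 ≤ (480 * (α ((k : ℤ) - 1) + G1 ((k : ℤ) - 1) + G2 ((k : ℤ) - 1))) ^ 2 := by
        gcongr; exact hbound k
    _ = _ := by rw [mul_pow]; rfl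

/-! ### The space `H⁴(φ)` as a weighted `ℓ²` space -/

theorem weight_mul_inner_ofWeighted (a : ℓ²(ℕ+, ℂ)) (k : ℕ+) :
    (k : ℝ) ^ (4 : ℝ) * ‖inner ℂ (φ k) (ofWeighted a : L2p)‖ = ‖a k‖ := by
  have hk : (0 : ℝ) < k := by exact_mod_cast k.pos
  rw [inner_φ_ofWeighted, norm_mul, norm_inv, norm_pow, Complex.norm_natCast,
    show (4 : ℝ) = ((4 : ℕ) : ℝ) by norm_num, Real.rpow_natCast]
  field_simp

theorem ofWeighted_mem_Hs (a : ℓ²(ℕ+, ℂ)) : (ofWeighted a : L2p) ∈ Hs 4 :=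
  ⟨(ofWeighted a).2, (summable_norm_sq a).congr fun k => by rw [weight_mul_inner_ofWeighted]⟩

theorem normHs_ofWeighted (a : ℓ²(ℕ+, ℂ)) : normHs 4 (ofWeighted a : L2p) = ‖a‖ := by
  simp only [normHs, weight_mul_inner_ofWeighted]
  rw [← norm_sq_eq_tsum, Real.sqrt_sq (norm_nonneg _)]

theorem exists_ofWeighted_eq {f : L2p} (hf : f ∈ Hs 4) : ∃ a, (ofWeighted a : L2p) = f := by
  have hmem : Memℓp (fun k : ℕ+ => (k : ℂ) ^ 4 * inner ℂ (φ k) f) 2 := by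
    refine memℓp_of_summable (hf.2.congr fun k => ?_)
    rw [norm_mul, norm_pow, Complex.norm_natCast, show (4 : ℝ) = ((4 : ℕ) : ℝ) by norm_num,
      Real.rpow_natCast]
  refine ⟨⟨_, hmem⟩, ?_⟩
  rw [← sub_eq_zero]
  refine eq_zero_of_inner_φ (Hφ.sub_mem (ofWeighted _).2 hf.1) fun k => ?_
  have hk : (k : ℂ) ≠ 0 := by exact_mod_cast k.ne_zero
  rw [inner_sub_right, inner_φ_ofWeighted, sub_eq_zero]
  change ((k : ℂ) ^ 4)⁻¹ * ((k : ℂ) ^ 4 * inner ℂ (φ k) f) = _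
  field_simp

theorem continuousInHs_ofWeighted {J : Set ℝ} {a : ℝ → ℓ²(ℕ+, ℂ)} (ha : ContinuousOn a J) :
    ContinuousInHs 4 J (fun t => (ofWeighted (a t) : L2p)) := by
  refine ⟨fun t _ => ofWeighted_mem_Hs _, fun t₀ ht₀ => ?_⟩
  have h := tendsto_iff_norm_sub_tendsto_zero.1 (ha t₀ ht₀)
  refine h.congr fun t => ?_
  rw [← Submodule.coe_sub, ← map_sub, normHs_ofWeighted]

/-- Continuity in `H⁴(φ)` implies continuity in `L²`. -/
theorem ContinuousInHs.continuousInHφ {J : Set ℝ} {ψ : ℝ → L2p} (hψ : ContinuousInHs 4 J ψ) :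
    ContinuousInHφ J ψ := by
  refine ⟨fun t ht => (hψ.1 t ht).1, fun t₀ ht₀ => ?_⟩
  rw [ContinuousWithinAt, tendsto_iff_norm_sub_tendsto_zero]
  have h1 := (hψ.2 t₀ ht₀).const_mul ‖ofWeighted‖
  rw [mul_zero] at h1
  refine squeeze_zero' (Eventually.of_forall fun _ => norm_nonneg _)
    (eventually_mem_nhdsWithin.mono fun t ht => ?_) h1
  obtain ⟨a, ha⟩ := exists_ofWeighted_eq (hψ.1 t ht)
  obtain ⟨b, hb⟩ := exists_ofWeighted_eq (hψ.1 t₀ ht₀)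
  rw [← ha, ← hb, ← Submodule.coe_sub, ← map_sub, normHs_ofWeighted]
  exact ofWeighted.le_opNorm _

/-- The weight `k⁴` commutes with the diagonal free flow. -/
theorem flow_ofWeighted (t : ℝ) (a : ℓ²(ℕ+, ℂ)) :
    flow basisφ μ t (ofWeighted a) = ofWeighted (phaseFlow μ t a) := by
  apply basisφ.repr.injective
  ext k
  rw [repr_flow, phaseFlow_apply, repr_ofWeighted, repr_ofWeighted, phaseFlow_apply]
  ring

/-! ### The singular part of the Duhamel integral -/

open Classical in
/-- The contribution to the Duhamel integral of the jump at the vertex: the sequence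
`k ↦ c_k ∫₀ᵗ e^{iμ_k s} h(s) ds`, or `0` if it is not in `ℓ²`. -/
def singularPart (h : ℝ → ℂ) (t : ℝ) : ℓ²(ℕ+, ℂ) :=
  if hm : Memℓp (fun k : ℕ+ => jumpCoeff k * ∫ s in (0 : ℝ)..t, phase (μ k) (-s) * h s) 2 then
    ⟨_, hm⟩ else 0

theorem intervalIntegrable_phase_mul {h : ℝ → ℂ} (hh : MemLp h 2 volume) (ν a b : ℝ) :
    IntervalIntegrable (fun s => phase ν (-s) * h s) volume a b := by
  have h1 : IntervalIntegrable h volume a b :=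
    intervalIntegrable_iff.2 (((hh.locallyIntegrable (by norm_num)).integrableOn_isCompact
      isCompact_uIcc).mono_set uIoc_subset_uIcc)
  exact h1.continuousOn_mul ((continuous_phase ν).comp continuous_neg).continuousOn

/-- The singular part lies in `ℓ²` and is continuous in time, by Bessel's inequality and the
boundedness of the jump coefficients. -/
theorem exists_singularPart_bound (T : ℝ) : ∃ C : ℝ, 0 ≤ C ∧ ∀ h : ℝ → ℂ, MemLp h 2 volume →
    (∀ t ∈ Icc 0 T, ∀ k, singularPart h t k
      = jumpCoeff k * ∫ s in (0 : ℝ)..t, phase (μ k) (-s) * h s) ∧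
    ∀ a ∈ Icc 0 T, ∀ b ∈ Icc 0 T, a ≤ b →
      ‖singularPart h b - singularPart h a‖ ^ 2 ≤ C * ∫ s in a..b, ‖h s‖ ^ 2 := by
  obtain ⟨C, hC0, hC⟩ := exists_bessel T
  refine ⟨256 * C, by positivity, fun h hh => ?_⟩
  have hbd : ∀ (k : ℕ+) (z : ℂ), ‖jumpCoeff k * z‖ ^ 2 ≤ 256 * ‖z‖ ^ 2 := fun k z => by
    rw [norm_mul, mul_pow, show (256 : ℝ) = 16 ^ 2 by norm_num]
    gcongr
    exact norm_jumpCoeff_le k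
  have happ : ∀ t ∈ Icc 0 T, ∀ k, singularPart h t k
      = jumpCoeff k * ∫ s in (0 : ℝ)..t, phase (μ k) (-s) * h s := by
    intro t ht k
    have hm : Memℓp (fun k : ℕ+ => jumpCoeff k * ∫ s in (0 : ℝ)..t, phase (μ k) (-s) * h s) 2 :=
      memℓp_of_summable (Summable.of_nonneg_of_le (fun _ => by positivity) (fun k => hbd k _)
        ((hC h hh 0 ⟨le_rfl, ht.1.trans ht.2⟩ t ht ht.1).1.mul_left 256))
    rw [singularPart, dif_pos hm]
  refine ⟨happ, fun a ha b hb hab => ?_⟩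
  obtain ⟨h1, h2⟩ := hC h hh a ha b hb hab
  have e : ∀ k, (singularPart h b - singularPart h a) k
      = jumpCoeff k * ∫ s in a..b, phase (μ k) (-s) * h s := fun k => by
    rw [lp.coeFn_sub, Pi.sub_apply, happ b hb, happ a ha, ← mul_sub,
      intervalIntegral.integral_interval_sub_left (intervalIntegrable_phase_mul hh _ _ _)
        (intervalIntegrable_phase_mul hh _ _ _)]
  rw [norm_sq_eq_tsum]
  simp only [e]
  have h3 := Summable.of_nonneg_of_le (fun _ => by positivity) (fun k => hbd k _) (h1.mul_left 256)
  calc _ ≤ ∑' k : ℕ+, 256 * ‖∫ s in a..b, phase (μ k) (-s) * h s‖ ^ 2 :=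
        h3.tsum_le_tsum (fun k => hbd k _) (h1.mul_left 256)
    _ = 256 * ∑' k : ℕ+, ‖∫ s in a..b, phase (μ k) (-s) * h s‖ ^ 2 := tsum_mul_left
    _ ≤ 256 * (C * ∫ s in a..b, ‖h s‖ ^ 2) := by gcongr
    _ = _ := by ring

theorem continuousOn_singularPart {h : ℝ → ℂ} (hh : MemLp h 2 volume) (T : ℝ) :
    ContinuousOn (singularPart h) (Icc 0 T) := by
  obtain ⟨C, hC0, hC⟩ := exists_singularPart_bound T
  intro t₀ ht₀
  rw [ContinuousWithinAt, tendsto_iff_norm_sub_tendsto_zero]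
  have hint : Integrable fun s => ‖h s‖ ^ 2 := hh.integrable_norm_pow (by norm_num)
  have hc : Continuous fun t => Real.sqrt (C * |∫ s in t₀..t, ‖h s‖ ^ 2|) := by
    have : Continuous fun t => ∫ s in t₀..t, ‖h s‖ ^ 2 :=
      intervalIntegral.continuous_primitive (fun _ _ => hint.intervalIntegrable) t₀
    fun_prop
  have h0 := hc.tendsto t₀
  simp only [intervalIntegral.integral_same, abs_zero, mul_zero, Real.sqrt_zero] at h0
  refine squeeze_zero' (Eventually.of_forall fun _ => norm_nonneg _)
    (eventually_mem_nhdsWithin.mono fun t ht => ?_) (h0.mono_left nhdsWithin_le_nhds)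
  refine Real.le_sqrt_of_sq_le ?_
  rcases le_total t₀ t with hle | hle
  · refine ((hC h hh).2 t₀ ht₀ t ht hle).trans ?_
    gcongr
    exact le_abs_self _
  · rw [norm_sub_rev, intervalIntegral.integral_symm, abs_neg]
    refine ((hC h hh).2 t ht t₀ ht₀ hle).trans ?_
    gcongr
    exact le_abs_self _

theorem singularPart_zero (h : ℝ → ℂ) : singularPart h 0 = 0 := by
  rw [singularPart]
  split_ifs with hm
  · ext k
    change jumpCoeff k * ∫ s in (0 : ℝ)..0, phase (μ k) (-s) * h s = 0
    rw [intervalIntegral.integral_same, mul_zero]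
  · rfl

theorem singularPart_sub {g h : ℝ → ℂ} (hg : MemLp g 2 volume) (hh : MemLp h 2 volume) {T t : ℝ}
    (ht : t ∈ Icc 0 T) :
    singularPart g t - singularPart h t = singularPart (fun s => g s - h s) t := by
  obtain ⟨C, -, hC⟩ := exists_singularPart_bound T
  ext k
  have h1 := (hC (fun s => g s - h s) (hg.sub hh)).1 t ht k
  rw [lp.coeFn_sub, Pi.sub_apply, (hC g hg).1 t ht, (hC h hh).1 t ht, h1, ← mul_sub,
    ← intervalIntegral.integral_sub (intervalIntegrable_phase_mul hg _ _ _)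
      (intervalIntegrable_phase_mul hh _ _ _)]
  simp only [mul_sub]

/-! ### Solutions in `H⁴(φ)` -/

/-- The Cauchy-Schwarz inequality against the constant function. -/
theorem sq_integral_le {f : ℝ → ℝ} {t : ℝ} (ht : 0 ≤ t) (hf : IntervalIntegrable f volume 0 t)
    (hf2 : IntervalIntegrable (fun s => f s ^ 2) volume 0 t) :
    (∫ s in (0 : ℝ)..t, f s) ^ 2 ≤ t * ∫ s in (0 : ℝ)..t, f s ^ 2 := by
  rcases ht.eq_or_lt with rfl | ht0
  · simp
  set I := ∫ s in (0 : ℝ)..t, f s with hI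
  have h0 : 0 ≤ ∫ s in (0 : ℝ)..t, (f s - I / t) ^ 2 :=
    intervalIntegral.integral_nonneg ht fun _ _ => sq_nonneg _
  have e : ∫ s in (0 : ℝ)..t, (f s - I / t) ^ 2
      = (∫ s in (0 : ℝ)..t, f s ^ 2) - 2 * (I / t) * I + (I / t) ^ 2 * t := by
    have e1 : ∀ s, (f s - I / t) ^ 2 = f s ^ 2 - 2 * (I / t) * f s + (I / t) ^ 2 := fun s => by ring
    simp only [e1]
    rw [intervalIntegral.integral_add (hf2.sub (hf.const_mul _)) intervalIntegrable_const,
      intervalIntegral.integral_sub hf2 (hf.const_mul _), intervalIntegral.integral_const_mul,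
      intervalIntegral.integral_const, sub_zero, smul_eq_mul, mul_comm t]
  rw [e] at h0
  have e2 : (∫ s in (0 : ℝ)..t, f s ^ 2) - 2 * (I / t) * I + (I / t) ^ 2 * t
      = (∫ s in (0 : ℝ)..t, f s ^ 2) - I ^ 2 / t := by field_simp; ring
  rw [e2, sub_nonneg, div_le_iff₀ ht0] at h0
  linarith

/-- The standard basis of `ℓ²`. -/
def stdBasis : HilbertBasis ℕ+ ℂ ℓ²(ℕ+, ℂ) := ⟨LinearIsometryEquiv.refl ℂ _⟩

theorem flow_stdBasis (t : ℝ) (a : ℓ²(ℕ+, ℂ)) : flow stdBasis μ t a = phaseFlow μ t a := rfl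

/-- The regular part of the control operator in `H⁴(φ)`. -/
def regularPart : ℓ²(ℕ+, ℂ) →L[ℂ] ℓ²(ℕ+, ℂ) := exists_regularPart.choose

theorem inner_φ_B_ofWeighted (a : ℓ²(ℕ+, ℂ)) (k : ℕ+) :
    inner ℂ (φ k) (B (ofWeighted a))
      = ((k : ℂ) ^ 4)⁻¹ * (jumpCoeff k * vertexValue a + regularPart a k) := by
  have hk : (k : ℂ) ≠ 0 := by exact_mod_cast k.ne_zero
  have h := exists_regularPart.choose_spec a k
  rw [show exists_regularPart.choose = regularPart from rfl] at h
  rw [← h]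
  field_simp

/-- The source of the singular part along the curve `x`. -/
def vertexSource (u : ℝ → ℝ) (x : ℝ → ℓ²(ℕ+, ℂ)) (s : ℝ) : ℂ :=
  (-Complex.I * (u s : ℂ)) * vertexValue (phaseFlow μ s (x s))

theorem norm_vertexSource_sub_le (u : ℝ → ℝ) (x y : ℝ → ℓ²(ℕ+, ℂ)) (s : ℝ) :
    ‖vertexSource u x s - vertexSource u y s‖ ≤ ‖vertexValue‖ * |u s| * ‖x s - y s‖ := by
  have h := vertexValue.le_opNorm (phaseFlow μ s (x s - y s))
  rw [LinearIsometryEquiv.norm_map, map_sub, map_sub] at h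
  rw [vertexSource, vertexSource, ← mul_sub, norm_mul, norm_mul, norm_neg, Complex.norm_I, one_mul,
    Complex.norm_real, Real.norm_eq_abs]
  calc _ ≤ |u s| * (‖vertexValue‖ * ‖x s - y s‖) := by gcongr
    _ = _ := by ring

theorem memLp_vertexSource {u : ℝ → ℝ} (hu : MemLp u 2 volume) {x : ℝ → ℓ²(ℕ+, ℂ)}
    (hx : Continuous x) {M : ℝ} (hM : ∀ s, ‖x s‖ ≤ M) : MemLp (vertexSource u x) 2 volume := by
  have hc : Continuous fun s => vertexValue (phaseFlow μ s (x s)) :=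
    vertexValue.continuous.comp (continuous_flow_apply stdBasis μ hx continuous_id)
  refine hu.of_le_mul (c := ‖vertexValue‖ * M) ?_ (Eventually.of_forall fun s => ?_)
  · exact ((Complex.continuous_ofReal.comp_aestronglyMeasurable hu.1).const_mul _).mul
      hc.aestronglyMeasurable
  · have h := norm_vertexSource_sub_le u x (fun _ => 0) s
    have h0 : vertexSource u (fun _ => 0) s = 0 := by simp [vertexSource]
    rw [h0, sub_zero, sub_zero] at h
    refine h.trans ?_
    rw [Real.norm_eq_abs]
    calc _ ≤ ‖vertexValue‖ * |u s| * M := by gcongr; exact hM s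
      _ = _ := by ring

/-- The mild equation in the weighted interaction picture has a continuous solution. -/
theorem exists_weighted_solution {u : ℝ → ℝ} (hu1 : Integrable u) (hu2 : MemLp u 2 volume) {T : ℝ}
    (hT : 0 ≤ T) (y₀ : ℓ²(ℕ+, ℂ)) :
    ∃ y : ℝ → ℓ²(ℕ+, ℂ), Continuous y ∧ MemLp (vertexSource u y) 2 volume ∧
      ∀ t ∈ Icc 0 T, y t = y₀ + (∫ s in (0 : ℝ)..t, interaction stdBasis μ regularPart u s (y s))
        + singularPart (vertexSource u y) t := by
  obtain ⟨C, hC0, hC⟩ := exists_singularPart_bound T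
  have hA := isIntegrableFamily_interaction stdBasis μ regularPart hu1
  let ext : C(Icc (0 : ℝ) T, ℓ²(ℕ+, ℂ)) → ℝ → ℓ²(ℕ+, ℂ) := fun x s => x (projIcc 0 T hT s)
  have hext : ∀ x, Continuous (ext x) := fun x => x.continuous.comp continuous_projIcc
  have hsrc : ∀ x, MemLp (vertexSource u (ext x)) 2 volume := fun x =>
    memLp_vertexSource hu2 (hext x) fun s => x.norm_coe_le_norm _
  let K : C(Icc (0 : ℝ) T, ℓ²(ℕ+, ℂ)) → C(Icc (0 : ℝ) T, ℓ²(ℕ+, ℂ)) := fun x =>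
    { toFun := fun t => y₀ + (∫ s in (0 : ℝ)..t, interaction stdBasis μ regularPart u s (ext x s))
        + singularPart (vertexSource u (ext x)) t
      continuous_toFun := by
        have h1 : Continuous fun t =>
            ∫ s in (0 : ℝ)..t, interaction stdBasis μ regularPart u s (ext x s) :=
          intervalIntegral.continuous_primitive
            (fun c d => hA.intervalIntegrable (hext x) c d) 0
        have h2 := continuousOn_iff_continuous_domRestrict.1
          (continuousOn_singularPart (hsrc x) T)
        exact (continuous_const.add (h1.comp continuous_subtype_val)).add h2 }
  -- `‖a + b‖² ≤ 2‖a‖² + 2‖b‖²` for the regular and the singular part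
  set M : ℝ := 2 * T * ‖regularPart‖ ^ 2 + 2 * C * ‖vertexValue‖ ^ 2 with hM
  have hu2' : Integrable fun s => |u s| ^ 2 := by
    simpa only [Real.norm_eq_abs] using hu2.integrable_norm_pow (by norm_num)
  obtain ⟨x, hx, -⟩ := existsUnique_volterra (g := fun s => M * |u s| ^ 2) (p := 2) hT
    (t₀ := 0) ⟨le_rfl, hT⟩ (hu2'.const_mul M) (fun s => by positivity) two_ne_zero K (by
      intro x y t
      set z : ℝ → ℝ := fun s => ‖ext x s - ext y s‖ with hz
      have hzc : Continuous z := ((hext x).sub (hext y)).norm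
      have huz : ∀ c d, IntervalIntegrable (fun s => |u s| * z s) volume c d := fun c d =>
        hu1.abs.intervalIntegrable.mul_continuousOn hzc.continuousOn
      have huz2 : ∀ c d, IntervalIntegrable (fun s => |u s| ^ 2 * z s ^ 2) volume c d := fun c d =>
        hu2'.intervalIntegrable.mul_continuousOn (hzc.pow 2).continuousOn
      set J := ∫ s in (0 : ℝ)..t, |u s| ^ 2 * z s ^ 2 with hJ
      have hJ0 : 0 ≤ J := intervalIntegral.integral_nonneg t.2.1 fun s _ => by positivity
      have ediff : K x t - K y t
          = (∫ s in (0 : ℝ)..t, interaction stdBasis μ regularPart u s (ext x s - ext y s))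
            + singularPart (fun s => vertexSource u (ext x) s - vertexSource u (ext y) s) t := by
        rw [← singularPart_sub (hsrc x) (hsrc y) t.2]
        simp only [map_sub]
        rw [intervalIntegral.integral_sub (hA.intervalIntegrable (hext x) _ _)
          (hA.intervalIntegrable (hext y) _ _)]
        simp only [K, ContinuousMap.coe_mk]
        abel
      have b1 : ‖∫ s in (0 : ℝ)..t, interaction stdBasis μ regularPart u s (ext x s - ext y s)‖ ^ 2
          ≤ T * ‖regularPart‖ ^ 2 * J := by
        have h1 : ‖∫ s in (0 : ℝ)..t, interaction stdBasis μ regularPart u s (ext x s - ext y s)‖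
            ≤ ‖regularPart‖ * ∫ s in (0 : ℝ)..t, |u s| * z s := by
          rw [← intervalIntegral.integral_const_mul]
          refine intervalIntegral.norm_integral_le_of_norm_le t.2.1
            (Eventually.of_forall fun s _ => ?_) ((huz _ _).const_mul _)
          rw [← mul_assoc]
          exact ContinuousLinearMap.le_of_opNorm_le _ (hA.norm_le s) _
        have h2 := sq_integral_le t.2.1 (huz 0 t) (by simpa only [mul_pow] using huz2 0 t)
        simp only [mul_pow] at h2
        calc _ ≤ (‖regularPart‖ * ∫ s in (0 : ℝ)..t, |u s| * z s) ^ 2 := by gcongr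
          _ = ‖regularPart‖ ^ 2 * (∫ s in (0 : ℝ)..t, |u s| * z s) ^ 2 := mul_pow _ _ _
          _ ≤ ‖regularPart‖ ^ 2 * (t * J) := by gcongr
          _ ≤ ‖regularPart‖ ^ 2 * (T * J) := by gcongr; exact t.2.2
          _ = _ := by ring
      have b2 : ‖singularPart (fun s => vertexSource u (ext x) s - vertexSource u (ext y) s) t‖ ^ 2
          ≤ C * ‖vertexValue‖ ^ 2 * J := by
        have hd := (hsrc x).sub (hsrc y)
        have h1 := (hC _ hd).2 0 ⟨le_rfl, hT⟩ t t.2 t.2.1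
        rw [singularPart_zero, sub_zero] at h1
        refine h1.trans ?_
        rw [mul_assoc C, hJ, ← intervalIntegral.integral_const_mul (‖vertexValue‖ ^ 2)]
        refine mul_le_mul_of_nonneg_left ?_ hC0
        refine intervalIntegral.integral_mono_on t.2.1
          (hd.integrable_norm_pow (by norm_num)).intervalIntegrable ((huz2 _ _).const_mul _)
          fun s _ => ?_
        have h2 := norm_vertexSource_sub_le u (ext x) (ext y) s
        exact (pow_le_pow_left₀ (norm_nonneg _) h2 2).trans (le_of_eq (by ring))
      rw [ediff]
      have b3 : ∫ s in (0 : ℝ)..t, M * |u s| ^ 2 * ‖x (projIcc 0 T hT s) - y (projIcc 0 T hT s)‖ ^ 2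
          = M * J := by
        rw [hJ, ← intervalIntegral.integral_const_mul]
        refine intervalIntegral.integral_congr fun s _ => ?_
        exact mul_assoc _ _ _
      rw [b3, abs_of_nonneg (by positivity), hM]
      have h3 := norm_add_le
        (∫ s in (0 : ℝ)..t, interaction stdBasis μ regularPart u s (ext x s - ext y s))
        (singularPart (fun s => vertexSource u (ext x) s - vertexSource u (ext y) s) t)
      refine (pow_le_pow_left₀ (norm_nonneg _) h3 2).trans ((add_sq_le).trans ?_)
      linarith)
  refine ⟨ext x, hext x, hsrc x, fun t ht => ?_⟩
  have h1 := congrArg (fun z : C(Icc (0 : ℝ) T, ℓ²(ℕ+, ℂ)) => z ⟨t, ht⟩) hx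
  have h2 : ext x t = x ⟨t, ht⟩ := by simp only [ext, projIcc_of_mem hT ht]
  rw [h2]
  exact h1.symm

/-- The integral equation can be checked on coordinates. -/
theorem IsSol.of_repr {H : Type*} [NormedAddCommGroup H] [InnerProductSpace ℂ H] [CompleteSpace H]
    {ι : Type*} (b : HilbertBasis ι ℂ H) {A : ℝ → H →L[ℂ] H} {g : ℝ → ℝ}
    (hA : IsIntegrableFamily A g) {t₀ T : ℝ} (hT : t₀ ≤ T) {f : H} {y : ℝ → H}
    (hy : ContinuousOn y (Icc t₀ T))
    (h : ∀ t ∈ Icc t₀ T, ∀ k, b.repr (y t) k = b.repr f k + ∫ s in t₀..t, b.repr (A s (y s)) k) :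
    IsSol A t₀ T t₀ f y := by
  refine ⟨hy, fun t ht => ?_⟩
  have hint := hA.intervalIntegrable_of_continuousOn hT hy ⟨le_rfl, hT⟩ ht
  apply b.repr.injective
  ext k
  have hck : ∀ f : H, b.repr f k = innerSL ℂ (b k) f := fun f => b.repr_apply_apply f k
  rw [h t ht k, map_add, lp.coeFn_add, Pi.add_apply, hck (∫ s in t₀..t, A s (y s)),
    ← ContinuousLinearMap.intervalIntegral_comp_comm _ hint]
  simp only [hck]

/-- Existence of mild solutions in `H⁴(φ)`. -/
theorem exists_isMild_Hs {u : ℝ → ℝ} (hu1 : Integrable u) (hu2 : MemLp u 2 volume) {T : ℝ}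
    (hT : 0 ≤ T) {ψ₀ : L2p} (hψ₀ : ψ₀ ∈ Hs 4) :
    ∃ ψ : ℝ → L2p, ContinuousInHs 4 (Icc 0 T) ψ ∧ IsMild u 0 T ψ₀ ψ := by
  obtain ⟨y₀, rfl⟩ := exists_ofWeighted_eq hψ₀
  obtain ⟨y, hy, hsrc, heq⟩ := exists_weighted_solution hu1 hu2 hT y₀
  obtain ⟨C, -, hC⟩ := exists_singularPart_bound T
  have hc : Continuous fun t => phaseFlow μ t (y t) :=
    continuous_flow_apply stdBasis μ hy continuous_id
  refine ⟨fun t => (ofWeighted (phaseFlow μ t (y t)) : L2p),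
    continuousInHs_ofWeighted hc.continuousOn, ?_⟩
  have hψ : Continuous fun t => ofWeighted (phaseFlow μ t (y t)) := ofWeighted.continuous.comp hc
  refine (isMild_iff_isSol hu1 hT hψ.continuousOn (ofWeighted y₀)).2 ?_
  have e : (fun t => flow basisφ μ (-t) (ofWeighted (phaseFlow μ t (y t))))
      = fun t => ofWeighted (y t) := by
    ext1 t
    rw [flow_ofWeighted, ← flow_stdBasis, ← flow_stdBasis, flow_neg_flow]
  rw [e]
  have hyc : Continuous fun t => ofWeighted (y t) := ofWeighted.continuous.comp hy
  rw [neg_zero, flow_zero]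
  refine IsSol.of_repr basisφ (isIntegrableFamily_interaction basisφ μ Bφ hu1) hT
    hyc.continuousOn fun t ht k => ?_
  have hint := (isIntegrableFamily_interaction stdBasis μ regularPart hu1).intervalIntegrable hy 0 t
  -- the `k`-th coordinate of the generator
  have hgen : ∀ s, basisφ.repr (interaction basisφ μ Bφ u s (ofWeighted (y s))) k
      = ((k : ℂ) ^ 4)⁻¹ * (lp.evalCLM ℂ (fun _ : ℕ+ => ℂ) 2 k
          (interaction stdBasis μ regularPart u s (y s))
        + jumpCoeff k * (phase (μ k) (-s) * vertexSource u y s)) := fun s => by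
    rw [interaction_apply, map_smul, lp.coeFn_smul, Pi.smul_apply, repr_flow,
      phaseFlow_apply, flow_ofWeighted, repr_basisφ, coe_Bφ, inner_φ_B_ofWeighted,
      interaction_apply, map_smul, flow_stdBasis, flow_stdBasis]
    change _ = ((k : ℂ) ^ 4)⁻¹ * ((-Complex.I * (u s : ℂ)) • phaseFlow μ (-s)
      (regularPart (phaseFlow μ s (y s))) k + _)
    rw [phaseFlow_apply, vertexSource, smul_eq_mul, smul_eq_mul]
    ring
  simp only [hgen]
  have hi1 : IntervalIntegrable (fun s => lp.evalCLM ℂ (fun _ : ℕ+ => ℂ) 2 k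
      (interaction stdBasis μ regularPart u s (y s))) volume 0 t :=
    ⟨ContinuousLinearMap.integrable_comp _ hint.1, ContinuousLinearMap.integrable_comp _ hint.2⟩
  rw [intervalIntegral.integral_const_mul, intervalIntegral.integral_add hi1
    ((intervalIntegrable_phase_mul hsrc _ _ _).const_mul _), intervalIntegral.integral_const_mul,
    ContinuousLinearMap.intervalIntegral_comp_comm _ hint, repr_ofWeighted, repr_ofWeighted,
    heq t ht, lp.coeFn_add, Pi.add_apply, lp.coeFn_add, Pi.add_apply, (hC _ hsrc).1 t ht k]
  change _ = _ + _ * ((∫ s in (0 : ℝ)..t, interaction stdBasis μ regularPart u s (y s)) k + _)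
  ring

theorem memLp_indicator_Ioo {T : ℝ} {u : ℝ → ℝ} (hu : MemLp u 2 (volume.restrict (Ioo 0 T))) :
    MemLp ((Ioo 0 T).indicator u) 2 volume ∧ Integrable ((Ioo 0 T).indicator u) :=
  ⟨(memLp_indicator_iff_restrict measurableSet_Ioo).2 hu,
    (integrable_indicator_iff measurableSet_Ioo).2 (hu.integrable (by norm_num))⟩

theorem ae_eq_indicator_Ioo {a T : ℝ} (u : ℝ → ℝ) (ha : 0 ≤ a) :
    ∀ᵐ s : ℝ, s ∈ Icc a T → (Ioo 0 T).indicator u s = u s := by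
  have h0 : ∀ᵐ s : ℝ, s ≠ 0 := Measure.ae_ne volume 0
  have hT : ∀ᵐ s : ℝ, s ≠ T := Measure.ae_ne volume T
  filter_upwards [h0, hT] with s h0 hT hs
  exact indicator_of_mem (show s ∈ Ioo 0 T from ⟨(ha.trans hs.1).lt_of_ne' h0, hs.2.lt_of_ne hT⟩) u

end Tadpole

end

theorem proposition3p3 :
    -- the setting: an orthonormal system of eigenfunctions, whose closed span is preserved by `B`
    (Orthonormal ℂ Tadpole.φ ∧
      (∀ k : ℕ+, Tadpole.IsLaplacian (Tadpole.φ k) ((Tadpole.μ k : ℂ) • Tadpole.φ k)) ∧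
      (∀ f ∈ Tadpole.Hφ, Tadpole.B f ∈ Tadpole.Hφ)) ∧
    ∀ (T : ℝ) (_ : 0 < T) (u : ℝ → ℝ) (_ : MemLp u 2 (volume.restrict (Ioo 0 T))),
      -- well-posedness in `H⁴(φ)`
      (∀ ψ₀ ∈ Tadpole.Hs 4, ∃ ψ : ℝ → Tadpole.L2p,
        (Tadpole.ContinuousInHs 4 (Icc 0 T) ψ ∧ Tadpole.IsMild u 0 T ψ₀ ψ) ∧
        ∀ ψ' : ℝ → Tadpole.L2p,
          Tadpole.ContinuousInHs 4 (Icc 0 T) ψ' → Tadpole.IsMild u 0 T ψ₀ ψ' →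
            EqOn ψ' ψ (Icc 0 T)) ∧
      -- the unitary propagator on `ℋ(φ)`
      (∃ Γ : ℝ → ℝ → (Tadpole.Hφ ≃ₗᵢ[ℂ] Tadpole.Hφ),
        Tadpole.IsUnitaryPropagator T Γ ∧
        ∀ s ∈ Icc 0 T, ∀ f : Tadpole.Hφ,
          Tadpole.IsMild u s T f (fun t => (Γ t s f : Tadpole.L2p)) ∧
          ∀ ψ : ℝ → Tadpole.L2p,
            Tadpole.ContinuousInHφ (Icc s T) ψ → Tadpole.IsMild u s T f ψ →
              ∀ t ∈ Icc s T, ψ t = (Γ t s f : Tadpole.L2p)) := by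
  refine ⟨⟨Tadpole.orthonormal_φ, Tadpole.isLaplacian_φ, fun f hf => Tadpole.B_mem_Hφ hf⟩,
    fun T hT u hu => ?_⟩
  -- `u` matters only on `(0, T)`; its extension by zero is integrable on `ℝ`
  obtain ⟨hv2, hv1⟩ := Tadpole.memLp_indicator_Ioo hu
  set v := (Ioo 0 T).indicator u
  have huv : ∀ {a : ℝ} {f : Tadpole.L2p} {ψ : ℝ → Tadpole.L2p}, 0 ≤ a →
      Tadpole.IsMild u a T f ψ → Tadpole.IsMild v a T f ψ := fun ha h =>
    Tadpole.isMild_congr ((Tadpole.ae_eq_indicator_Ioo u ha).mono fun s h hs => (h hs).symm) h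
  have hvu : ∀ {a : ℝ} {f : Tadpole.L2p} {ψ : ℝ → Tadpole.L2p}, 0 ≤ a →
      Tadpole.IsMild v a T f ψ → Tadpole.IsMild u a T f ψ := fun ha h =>
    Tadpole.isMild_congr (Tadpole.ae_eq_indicator_Ioo u ha) h
  refine ⟨fun ψ₀ hψ₀ => ?_, ?_⟩
  · obtain ⟨ψ, hψ, hψm⟩ := Tadpole.exists_isMild_Hs hv1 hv2 hT.le hψ₀
    refine ⟨ψ, ⟨hψ, hvu le_rfl hψm⟩, fun ψ' hψ' hψm' => ?_⟩
    exact Tadpole.isMild_unique hv1 hT.le hψ₀.1 hψ'.continuousInHφ hψ.continuousInHφ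
      (huv le_rfl hψm') hψm
  · obtain ⟨Γ, hΓ, hm⟩ := Tadpole.exists_propagator hv1 hT.le
    refine ⟨Γ, hΓ, fun s hs f => ⟨hvu hs.1 (hm s hs f), fun ψ hψ hψm => ?_⟩⟩
    have hc : Tadpole.ContinuousInHφ (Icc s T) fun t => (Γ t s f : Tadpole.L2p) :=
      ⟨fun t _ => (Γ t s f).2, continuous_subtype_val.comp_continuousOn
        ((hΓ.cont f).comp (f := fun t : ℝ => (t, s)) (by fun_prop)
          fun t ht => ⟨⟨hs.1.trans ht.1, ht.2⟩, hs⟩)⟩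
    exact Tadpole.isMild_unique hv1 hs.2 f.2 hψ hc (huv hs.1 hψm) (hm s hs f)
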